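/- Let $X$ be a countable set and let $k:X\times X\to\mathbb R$ be the rate matrix of an irreducible continuous-time Markov chain $(Z_t)_{t\ge0}$ on $X$: $k(x,y)\ge 0$ for $y\ne x$, and $k(x,x)=-M_1(x)$, where we assume, for every $x\in X$, $$M_1(x)=\sum_{y\ne x}k(x,y)<\infty,\qquad M_2(x)=\sum_{y\ne x}k(x,y)\sum_{z\ne y}k(y,z)<\infty .$$ Let $Lf(x)=\sum_{y}k(x,y)(f(y)-f(x))$ be its generator and $P_tf(x)=\mathbb E(f(Z_t)\mid Z_0=x)$ its semigroup on bounded functions. Let $\mu$ be a probability measure on $X$ with density $\pi>0$ with respect to the counting measure such that $\pi(x)k(x,y)=\pi(y)k(y,x)$ for all $x,y$, and assume $P_t1=1$ for all $t\ge 0$. Let $\ell^{\infty,+}(X)$ be the set of bounded $f:X\to\mathbb R$ with $\inf f>0$, let $\mathcal P_*(X)$ be the set of $\rho:X\to(0,\infty)$ with $\int_X\rho\,d\mu=1$, and let $\mathcal P_*^+(X)=\mathcal P_*(X)\cap\ell^{\infty,+}(X)$. Let $p\in(1,2)$ and $\kappa\in\mathbb R$. Put $\Phi_p(r)=\frac{r^p-r}{p(p-1)}$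 for $r\ge0$, $\mathcal H_p(\rho)=\int_X\Phi_p(\rho)\,d\mu$ and $\Upsilon(r)=e^r-1-r$. For $f\in\ell^{\infty,+}(X)$ define $$\Psi^{(p)}_\Upsilon(f)(x)=-\sum_{y\in X}k(x,y)\big[\Phi_p'(f(y))-\Phi_p'(f(x))-\Phi_p''(f(x))(f(y)-f(x))\big],$$ $$\Psi^{(p)}_{2,\Upsilon}(f)=\tfrac12\Big(L\Psi^{(p)}_\Upsilon(f)-B_{\Upsilon'}\big(\log f,L(\Phi_p'(f))\big)\Big),\quad B_{\Upsilon'}(g,h)(x)=\sum_{y\in X}k(x,y)\Upsilon'(g(y)-g(x))(h(y)-h(x)).$$ For $\rho\in\mathcal P_*^+(X)$ let $\mathcal I_p(\rho)=\frac1{2-p}\int_X\rho\,\Psi^{(p)}_\Upsilon(\rho)\,d\mu$. For $\rho\in\mathcal P_*(X)$ let $$\mathcal E(\rho,\Phi_p'(\rho))=\frac12\sum_{x,y\in X}k(x,y)(\rho(y)-\rho(x))\big(\Phi_p'(\rho(y))-\Phi_p'(\rho(x))\big)\pi(x)\in[0,\infty].$$ We say that $CD^{(p)}_\Upsilon(\kappa,\infty)$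 holds if $\Psi^{(p)}_{2,\Upsilon}(f)(x)\ge\frac{\kappa}{2-p}\Psi^{(p)}_\Upsilon(f)(x)$ for all $x\in X$ and $f\in\ell^{\infty,+}(X)$. Assume $M_1\in\ell^2(\mu)$ and $M_2\in\ell^1(\mu)$. Then the following hold. 1. For every $\rho\in\mathcal P_*^+(X)$ the integral defining $\mathcal I_p(\rho)$ converges absolutely and $\mathcal I_p(\rho)=\mathcal E(\rho,\Phi_p'(\rho))\ge 0$. This formula is used to extend $\mathcal I_p$ to $\mathcal P_*(X)$ with values in $[0,\infty]$. 2. For every $f\in\mathcal P_*^+(X)$ and $t\ge0$ we have $P_tf\in\mathcal P_*^+(X)$, the integrals over $X$ below converge absolutely, and (with one-sided derivatives at $t=0$) $$\frac{d}{dt}\mathcal H_p(P_tf)=-\mathcal I_p(P_tf),\qquad \frac{d^2}{dt^2}\mathcal H_p(P_tf)=2\int_X P_tf\,\Psi^{(p)}_{2,\Upsilon}(P_tf)\,d\mu .$$ 3. If $CD^{(p)}_\Upsilon(\kappa,\infty)$ holds, then $\frac{d^2}{dt^2}\mathcal H_p(P_tf)\ge-2\kappa\frac{d}{dt}\mathcal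 H_p(P_tf)$ for all $t>0$ and $f\in\mathcal P_*^+(X)$. 4. If $CD^{(p)}_\Upsilon(\kappa,\infty)$ holds with $\kappa>0$, then the Beckner inequality $\mathcal H_p(f)\le\frac1{2\kappa}\mathcal I_p(f)$ holds for every $f\in\mathcal P_*(X)$ with $\mathcal H_p(f)<\infty$. -/

import Mathlib

open Set
open scoped ENNReal

namespace BecknerChain

noncomputable section

/-! ### Transition rates, generator and reversible measure -/

open Classical in
/-- The jump rates: `k x y` for `y ≠ x`, and `0` on the diagonal. -/
def rate {X : Type*} (k : X → X → ℝ) (x y : X) : ℝ :=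
  if y = x then 0 else k x y

/-- `M₁(x) = ∑_{y ≠ x} k(x,y)`. -/
def M1 {X : Type*} (k : X → X → ℝ) (x : X) : ℝ := ∑' y, rate k x y

/-- `M₂(x) = ∑_{y ≠ x} k(x,y) ∑_{z ≠ y} k(y,z)`. -/
def M2 {X : Type*} (k : X → X → ℝ) (x : X) : ℝ := ∑' y, rate k x y * M1 k y

/-- The generator `L f (x) = ∑_y k(x,y) (f(y) - f(x))`. -/
def gen {X : Type*} (k : X → X → ℝ) (f : X → ℝ) (x : X) : ℝ :=
  ∑' y, k x y * (f y - f x)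

/-- Integration against the measure `μ` on the countable set `X` whose density with respect to
the counting measure is `π`. -/
def integ {X : Type*} (π : X → ℝ) (f : X → ℝ) : ℝ := ∑' x, f x * π x

/-! ### The Markov semigroup -/

open Classical in
/-- Feller's iteration: `transIter k n t x y` is the probability that the continuous-time chain
with rates `k`, started in `x`, is in `y` at time `t ≥ 0` after fewer than `n` jumps. The chain
waits an exponential time of parameter `-k x x` in `x` and then jumps to `z ≠ x` with
probability `k x z / (-k x x)`. -/
def transIter {X : Type*} (k : X → X → ℝ) : ℕ → ℝ → X → X → ℝ≥0∞
  | 0 => fun _ _ _ => 0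
  | n + 1 => fun t x y =>
      ENNReal.ofReal (Real.exp (k x x * t)) * (if x = y then 1 else 0)
        + ∫⁻ s in Ioc (0 : ℝ) t, ENNReal.ofReal (Real.exp (k x x * s)) *
            ∑' z, ENNReal.ofReal (rate k x z) * transIter k n (t - s) z y

/-- The transition function `p_t(x,y) = ℙ(Z_t = y | Z_0 = x)` of the (minimal) chain `Z` with
rates `k`. -/
def trans {X : Type*} (k : X → X → ℝ) (t : ℝ) (x y : X) : ℝ≥0∞ :=
  ⨆ n, transIter k n t x y

/-- The semigroup `P_t f (x) = 𝔼 (f(Z_t) | Z_0 = x)` on bounded functions. -/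
def semigroup {X : Type*} (k : X → X → ℝ) (t : ℝ) (f : X → ℝ) (x : X) : ℝ :=
  ∑' y, (trans k t x y).toReal * f y

/-- The standing setting: `k` is the rate matrix of an irreducible, positive recurrent,
non-explosive continuous-time Markov chain on `X` which is reversible with respect to the
probability measure with positive density `π`. -/
structure IsReversibleMarkovChain {X : Type*} (k : X → X → ℝ) (π : X → ℝ) : Prop where
  /-- transition rates are nonnegative -/
  nonneg : ∀ x y, y ≠ x → 0 ≤ k x y
  /-- `M₁(x) < ∞` -/
  summable_rate : ∀ x, Summable (rate k x)
  /-- rows sum to zero: `k(x,x) = -∑_{y ≠ x} k(x,y)` -/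
  diag : ∀ x, k x x = -M1 k x
  /-- `M₂(x) < ∞` -/
  summable_rate_M1 : ∀ x, Summable (fun y => rate k x y * M1 k y)
  /-- irreducibility: any two states are joined by a path with at least one step along which
  all rates are positive -/
  irreducible : ∀ x y, Relation.TransGen (fun a b => 0 < k a b) x y
  pi_pos : ∀ x, 0 < π x
  /-- `μ` is a probability measure -/
  pi_sum : HasSum π 1
  detailed_balance : ∀ x y, π x * k x y = π y * k y x
  /-- stochastic completeness `P_t 1 = 1` -/
  stochastically_complete : ∀ t, 0 ≤ t → ∀ x, ∑' y, trans k t x y = 1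

/-! ### Function spaces -/

/-- `ℓ^{∞,+}(X)`: bounded functions that are bounded below by a positive constant. -/
def LinftyPos (X : Type*) : Set (X → ℝ) :=
  {f | (∃ C, ∀ x, |f x| ≤ C) ∧ ∃ c > 0, ∀ x, c ≤ f x}

/-- `𝒫(X)`: probability densities with respect to `μ`. -/
def Dens {X : Type*} (π : X → ℝ) : Set (X → ℝ) :=
  {ρ | (∀ x, 0 ≤ ρ x) ∧ HasSum (fun x => ρ x * π x) 1}

/-- `𝒫_*(X)`: strictly positive probability densities. -/
def DensPos {X : Type*} (π : X → ℝ) : Set (X → ℝ) :=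
  {ρ | ρ ∈ Dens π ∧ ∀ x, 0 < ρ x}

/-- `𝒫_*^+(X) = 𝒫_*(X) ∩ ℓ^{∞,+}(X)`. -/
def DensPosPlus {X : Type*} (π : X → ℝ) : Set (X → ℝ) :=
  DensPos π ∩ LinftyPos X

/-! ### The operators -/

/-- `Υ(y) = e^y - 1 - y`. -/
def Upsilon (y : ℝ) : ℝ := Real.exp y - 1 - y

/-- `Λ_H(w,z) = H(w) - H(z) - H'(z) (w - z)`. -/
def Lam (H : ℝ → ℝ) (w z : ℝ) : ℝ := H w - H z - deriv H z * (w - z)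

/-- `Λ̄_H(f)(x) = ∑_y k(x,y) Λ_H(f(y), f(x))`. -/
def LamBar {X : Type*} (k : X → X → ℝ) (H : ℝ → ℝ) (f : X → ℝ) (x : X) : ℝ :=
  ∑' y, k x y * Lam H (f y) (f x)

/-- `B_H(f,g)(x) = ∑_y k(x,y) H(f(y) - f(x)) (g(y) - g(x))`. -/
def BOp {X : Type*} (k : X → X → ℝ) (H : ℝ → ℝ) (f g : X → ℝ) (x : X) : ℝ :=
  ∑' y, k x y * H (f y - f x) * (g y - g x)

/-- `Φ_p(r) = (r^p - r) / (p (p - 1))`, for `r ≥ 0`. -/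
def Phi (p r : ℝ) : ℝ := (r ^ p - r) / (p * (p - 1))

/-- `Φ_p'`, used on `(0,∞)` only. -/
def PhiD (p : ℝ) : ℝ → ℝ := deriv (Phi p)

theorem PhiD_eq {p r : ℝ} (hr : 0 < r) :
    PhiD p r = (p * r ^ (p - 1) - 1) / (p * (p - 1)) :=
  (((Real.hasDerivAt_rpow_const (Or.inl hr.ne')).sub (hasDerivAt_id r)).div_const _).deriv

/-- `Ψ_Υ^{(p)}(f) = -Λ̄_{Φ_p'}(f)`. -/
def Psi {X : Type*} (k : X → X → ℝ) (p : ℝ) (f : X → ℝ) (x : X) : ℝ :=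
  -LamBar k (PhiD p) f x

/-- `Ψ_{2,Υ}^{(p)}(f) = (1/2) (L Ψ_Υ^{(p)}(f) - B_{Υ'}(log f, L Φ_p'(f)))`. -/
def Psi2 {X : Type*} (k : X → X → ℝ) (p : ℝ) (f : X → ℝ) (x : X) : ℝ :=
  (1 / 2) * (gen k (Psi k p f) x -
    BOp k (deriv Upsilon) (fun y => Real.log (f y)) (gen k (fun y => PhiD p (f y))) x)

/-- The condition `CD_Υ^{(p)}(κ,∞)`. -/
def CD {X : Type*} (k : X → X → ℝ) (p κ : ℝ) : Prop :=
  ∀ x : X, ∀ f ∈ LinftyPos X, κ / (2 - p) * Psi k p f x ≤ Psi2 k p f x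

/-! ### Entropy, Fisher information and the Beckner inequality -/

/-- `ℋ_p(ρ) = ∫ Φ_p(ρ) dμ`. -/
def entropy {X : Type*} (π : X → ℝ) (p : ℝ) (ρ : X → ℝ) : ℝ :=
  integ π (fun x => Phi p (ρ x))

/-- `ℐ_p(ρ) = (1/(2-p)) ∫ ρ Ψ_Υ^{(p)}(ρ) dμ`, for `ρ ∈ 𝒫_*^+(X)`. -/
def fisher {X : Type*} (k : X → X → ℝ) (π : X → ℝ) (p : ℝ) (ρ : X → ℝ) : ℝ :=
  1 / (2 - p) * integ π (fun x => ρ x * Psi k p ρ x)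

/-- The extension `ℐ_p(ρ) = ℰ(ρ, Φ_p'(ρ)) ∈ [0,∞]` to `ρ ∈ 𝒫_*(X)`, where
`ℰ(f,g) = (1/2) ∑_x ∑_y k(x,y) (f(y) - f(x)) (g(y) - g(x)) π(x)`. All summands are nonnegative
here because `Φ_p'` is increasing on `(0,∞)`. -/
def fisherExt {X : Type*} (k : X → X → ℝ) (π : X → ℝ) (p : ℝ) (ρ : X → ℝ) : ℝ≥0∞ :=
  ∑' x, ∑' y, ENNReal.ofReal
    (1 / 2 * (k x y * (ρ y - ρ x) * (PhiD p (ρ y) - PhiD p (ρ x)) * π x))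

/-- The Beckner inequality `Bec(α)`: `ℋ_p(f) ≤ (1/(2α)) ℐ_p(f)` for all `f ∈ 𝒫_*(X)` with
`ℋ_p(f) < ∞`. As `Φ_p` is bounded below and `μ` is finite, `ℋ_p(f) < ∞` says that `Φ_p(f)` is
summable. By Jensen's inequality `ℋ_p(f) ≥ 0`, so that `ENNReal.ofReal` keeps its value. -/
def Bec {X : Type*} (k : X → X → ℝ) (π : X → ℝ) (p α : ℝ) : Prop :=
  ∀ f ∈ DensPos π, Summable (fun x => Phi p (f x) * π x) →
    ENNReal.ofReal (entropy π p f) ≤ ENNReal.ofReal (1 / (2 * α)) * fisherExt k π p f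

end

end BecknerChain

open BecknerChain

open MeasureTheory Filter Topology

namespace BecknerChain

/-! Write u = P_t f, φ = Φ_p'(u), H for the entropy and E for the energy E(u,φ). Reversibility makes
k(x,y)π(x) a symmetric weight on edges, so integration by parts amounts to averaging a series over X
× X with its transpose. For functions with values in [c,C], c > 0, the edge series are dominated by
multiples of (1 + M₁(x)) + (1 + M₁(y)), which is summable against the weight because M₁ ∈ ℓ²(μ)
(`summable_edgeWeight_growth`). The semigroup preserves [c,C], so these bounds are uniform in time
and permit termwise differentiation (`hasDerivWithinAt_tsum_of_bounded`).

Feller's iteration yields the backward equation ∂ₜu = Lu, hence H' = -E(u,φ) and E' = E(Lu,φ) + E(u,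
u^(p-2) Lu). The lemmas `fisher_eq_energy` and `integ_mul_Psi2` recognise the Fisher information and
the integral of u Ψ₂ in these expressions; they rest on Ψ(u) = u^(p-2) Lu - Lφ and on u(x) Υ'(log
u(y) - log u(x)) = u(y) - u(x).

Integrating the curvature condition against u gives E' ≤ -2κE. If κ > 0, then H - E/(2κ) is
nondecreasing and E decays exponentially. Since E controls the squared increment across each edge,
irreducibility flattens u, conservation of mass forces the limit 1, and H → 0. Comparing time 0 with
infinity gives the Beckner inequality for f in [c,C]. A general density is clamped and renormalised
(`bec_of_forall_Icc`): clamping does not increase the energy, and the entropies converge by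
domination. -/

theorem measurable_lintegral_convolution {G H : ℝ → ℝ≥0∞} (hG : Measurable G)
    (hH : Measurable H) : Measurable (fun t => ∫⁻ s in Ioc (0 : ℝ) t, G s * H (t - s)) := by
  have hS : MeasurableSet {q : ℝ × ℝ | 0 < q.2 ∧ q.2 ≤ q.1} :=
    (measurableSet_lt measurable_const measurable_snd).inter
      (measurableSet_le measurable_snd measurable_fst)
  have hm : Measurable ({q : ℝ × ℝ | 0 < q.2 ∧ q.2 ≤ q.1}.indicator
      (fun q => G q.2 * H (q.1 - q.2))) :=
    ((hG.comp measurable_snd).mul (hH.comp (measurable_fst.sub measurable_snd))).indicator hS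
  have := hm.lintegral_prod_right' (ν := volume)
  convert this using 2 with t
  rw [← lintegral_indicator measurableSet_Ioc]
  rfl

/-- Monotone convergence for the counting measure. -/
theorem tsum_iSup_eq_iSup_tsum {X : Type*} {F : ℕ → X → ℝ≥0∞} (hF : Monotone F) :
    ∑' x, ⨆ n, F n x = ⨆ n, ∑' x, F n x := by
  let _ : MeasurableSpace X := ⊤
  simp_rw [← lintegral_count]
  exact lintegral_iSup (fun _ => measurable_from_top) hF

/-! ### The transition function, the semigroup and the backward equation -/

section Semigroup

variable {X : Type*} {k : X → X → ℝ} {π : X → ℝ}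

theorem transIter_le_succ (k : X → X → ℝ) (n : ℕ) (t : ℝ) (x y : X) :
    transIter k n t x y ≤ transIter k (n + 1) t x y := by
  induction n generalizing t x y with
  | zero => simp [transIter]
  | succ n ih =>
    refine add_le_add le_rfl (lintegral_mono fun s => ?_)
    exact mul_le_mul_right (ENNReal.tsum_le_tsum fun z => mul_le_mul_right (ih _ _ _) _) _

theorem transIter_mono (k : X → X → ℝ) (t : ℝ) (x y : X) :
    Monotone (fun n => transIter k n t x y) :=
  monotone_nat_of_le_succ fun n => transIter_le_succ k n t x y

theorem measurable_transIter [Countable X] (k : X → X → ℝ) (n : ℕ) (x y : X) :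
    Measurable (fun t => transIter k n t x y) := by
  induction n generalizing x y with
  | zero => simp only [transIter]; exact measurable_const
  | succ n ih =>
    simp only [transIter]
    refine Measurable.add (by fun_prop) (measurable_lintegral_convolution
      (G := fun s => ENNReal.ofReal (Real.exp (k x x * s)))
      (H := fun r => ∑' z, ENNReal.ofReal (rate k x z) * transIter k n r z y)
      (by fun_prop) ?_)
    exact Measurable.tsum fun z => (ih z y).const_mul _

theorem measurable_trans [Countable X] (k : X → X → ℝ) (x y : X) :
    Measurable (fun t => trans k t x y) :=
  Measurable.iSup fun n => measurable_transIter k n x y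

open Classical in
/-- The backward integral equation of the transition function. -/
theorem trans_eq [Countable X] (k : X → X → ℝ) (t : ℝ) (x y : X) :
    trans k t x y = ENNReal.ofReal (Real.exp (k x x * t)) * (if x = y then 1 else 0)
      + ∫⁻ s in Ioc (0 : ℝ) t, ENNReal.ofReal (Real.exp (k x x * s)) *
          ∑' z, ENNReal.ofReal (rate k x z) * trans k (t - s) z y := by
  -- Dropping the zeroth iterate keeps the supremum and exposes the recursion.
  have h1 : trans k t x y = ⨆ n, transIter k (n + 1) t x y :=
    ((transIter_mono k t x y).iSup_nat_add 1).symm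
  rw [h1]
  simp only [transIter]
  rw [← ENNReal.add_iSup, ← lintegral_iSup]
  · congr 1
    refine lintegral_congr fun s => ?_
    rw [← ENNReal.mul_iSup, ← tsum_iSup_eq_iSup_tsum]
    · simp_rw [← ENNReal.mul_iSup]
      rfl
    · intro n m hnm z
      dsimp only
      gcongr
      exact transIter_mono k _ _ _ hnm
  · intro n
    refine Measurable.mul (by fun_prop) (Measurable.tsum fun z => ?_)
    exact ((measurable_transIter k n z y).comp (measurable_const.sub measurable_id)).const_mul _
  · intro n m hnm s
    dsimp only
    gcongr with z
    exact transIter_mono k _ _ _ hnm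

/-- The semigroup on functions with values in `[0,∞]`. -/
noncomputable def semigroupE (k : X → X → ℝ) (t : ℝ) (f : X → ℝ≥0∞) (x : X) : ℝ≥0∞ :=
  ∑' y, trans k t x y * f y

theorem measurable_semigroupE [Countable X] (k : X → X → ℝ) (f : X → ℝ≥0∞) (x : X) :
    Measurable (fun t => semigroupE k t f x) :=
  Measurable.tsum fun y => (measurable_trans k x y).mul_const _

/-- With values in [0,∞], Tonelli allows summing the equation for the transition function against f
without any integrability check. -/
theorem semigroupE_eq [Countable X] (k : X → X → ℝ) (f : X → ℝ≥0∞) (t : ℝ) (x : X) :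
    semigroupE k t f x = ENNReal.ofReal (Real.exp (k x x * t)) * f x
      + ∫⁻ s in Ioc (0 : ℝ) t, ENNReal.ofReal (Real.exp (k x x * s)) *
          ∑' z, ENNReal.ofReal (rate k x z) * semigroupE k (t - s) f z := by
  classical
  unfold semigroupE
  have hmeas : ∀ y, Measurable (fun s => ENNReal.ofReal (Real.exp (k x x * s)) *
      ∑' z, ENNReal.ofReal (rate k x z) * trans k (t - s) z y) := fun y =>
    Measurable.mul (by fun_prop) (Measurable.tsum fun z =>
      ((measurable_trans k z y).comp (measurable_const.sub measurable_id)).const_mul _)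
  have h1 : ∀ y, trans k t x y * f y =
      ENNReal.ofReal (Real.exp (k x x * t)) * (if x = y then f y else 0)
      + ∫⁻ s in Ioc (0 : ℝ) t, ENNReal.ofReal (Real.exp (k x x * s)) *
          (∑' z, ENNReal.ofReal (rate k x z) * trans k (t - s) z y) * f y := by
    intro y
    rw [trans_eq, add_mul, lintegral_mul_const _ (hmeas y)]
    congr 1
    split_ifs <;> simp
  simp_rw [h1]
  rw [ENNReal.tsum_add, ENNReal.tsum_mul_left, tsum_ite_eq',
    ← lintegral_tsum fun y => ((hmeas y).mul_const _).aemeasurable]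
  congr 1
  refine lintegral_congr fun s => ?_
  simp_rw [mul_assoc]
  rw [ENNReal.tsum_mul_left]
  congr 1
  simp_rw [← ENNReal.tsum_mul_left, ← ENNReal.tsum_mul_right]
  rw [ENNReal.tsum_comm]
  simp_rw [mul_assoc]

namespace IsReversibleMarkovChain

variable (h : IsReversibleMarkovChain k π)
include h

theorem rate_nonneg (x y : X) : 0 ≤ rate k x y := by
  unfold rate
  split_ifs with hxy
  · exact le_rfl
  · exact h.nonneg x y hxy

theorem M1_nonneg (x : X) : 0 ≤ M1 k x := tsum_nonneg (h.rate_nonneg x)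

theorem hasSum_trans {t : ℝ} (ht : 0 ≤ t) (x : X) :
    HasSum (fun y => (trans k t x y).toReal) 1 := by
  have h1 := h.stochastically_complete t ht x
  have hne : ∑' y, trans k t x y ≠ ⊤ := by simp [h1]
  have := (ENNReal.summable_toReal hne).hasSum
  rwa [← ENNReal.tsum_toReal_eq (fun y => ENNReal.ne_top_of_tsum_ne_top hne y), h1,
    ENNReal.toReal_one] at this

theorem summable_trans_mul {f : X → ℝ} {C : ℝ} (hf : ∀ x, |f x| ≤ C) {t : ℝ} (ht : 0 ≤ t)
    (x : X) : Summable (fun y => (trans k t x y).toReal * f y) := by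
  refine Summable.of_norm_bounded ((h.hasSum_trans ht x).summable.mul_right C) fun y => ?_
  rw [norm_mul, Real.norm_of_nonneg ENNReal.toReal_nonneg]
  exact mul_le_mul_of_nonneg_left (hf y) ENNReal.toReal_nonneg

theorem semigroup_mem_Icc {f : X → ℝ} {c C : ℝ} (hf : ∀ x, f x ∈ Icc c C) {t : ℝ}
    (ht : 0 ≤ t) (x : X) : semigroup k t f x ∈ Icc c C := by
  have hs := (h.summable_trans_mul (f := f) (C := max |c| |C|)
    (fun x => abs_le_max_abs_abs (hf x).1 (hf x).2) ht x).hasSum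
  have h1 := h.hasSum_trans ht x
  constructor
  · have := hasSum_le (fun y => mul_le_mul_of_nonneg_left (hf y).1 ENNReal.toReal_nonneg)
      (h1.mul_right c) hs
    simpa [semigroup] using this
  · have := hasSum_le (fun y => mul_le_mul_of_nonneg_left (hf y).2 ENNReal.toReal_nonneg)
      hs (h1.mul_right C)
    simpa [semigroup] using this

theorem semigroupE_ofReal {f : X → ℝ} {C : ℝ} (hf : ∀ x, f x ∈ Icc 0 C) {t : ℝ}
    (ht : 0 ≤ t) (x : X) :
    semigroupE k t (fun y => ENNReal.ofReal (f y)) x = ENNReal.ofReal (semigroup k t f x) := by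
  have hC : ∀ x, |f x| ≤ C := fun x => by rw [abs_of_nonneg (hf x).1]; exact (hf x).2
  have hne : ∑' y, trans k t x y ≠ ⊤ := by simp [h.stochastically_complete t ht x]
  unfold semigroup semigroupE
  rw [ENNReal.ofReal_tsum_of_nonneg (fun y => mul_nonneg ENNReal.toReal_nonneg (hf y).1)
    (h.summable_trans_mul hC ht x)]
  refine tsum_congr fun y => ?_
  rw [ENNReal.ofReal_mul ENNReal.toReal_nonneg,
    ENNReal.ofReal_toReal (ENNReal.ne_top_of_tsum_ne_top hne y)]

theorem summable_rate_mul {g : X → ℝ} {C : ℝ} (hg : ∀ x, |g x| ≤ C) (x : X) :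
    Summable (fun y => rate k x y * g y) := by
  refine Summable.of_norm_bounded ((h.summable_rate x).mul_right C) fun y => ?_
  rw [norm_mul, Real.norm_of_nonneg (h.rate_nonneg x y)]
  exact mul_le_mul_of_nonneg_left (hg y) (h.rate_nonneg x y)

theorem tsum_rate_mul_mem_Icc {g : X → ℝ} {C : ℝ} (hg : ∀ x, g x ∈ Icc 0 C) (x : X) :
    ∑' y, rate k x y * g y ∈ Icc 0 (M1 k x * C) := by
  have hC : ∀ x, |g x| ≤ C := fun x => by rw [abs_of_nonneg (hg x).1]; exact (hg x).2
  refine ⟨tsum_nonneg fun y => mul_nonneg (h.rate_nonneg x y) (hg y).1, ?_⟩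
  exact hasSum_le (fun y => mul_le_mul_of_nonneg_left (hg y).2 (h.rate_nonneg x y))
    (h.summable_rate_mul hC x).hasSum ((h.summable_rate x).hasSum.mul_right C)

theorem gen_eq {g : X → ℝ} {x : X} (hs : Summable fun y => rate k x y * g y) :
    gen k g x = ∑' y, rate k x y * g y - M1 k x * g x := by
  unfold gen M1
  rw [← tsum_mul_right, ← hs.tsum_sub ((h.summable_rate x).mul_right _)]
  refine tsum_congr fun y => ?_
  unfold rate
  split_ifs with hxy
  · simp [hxy]
  · ring

/-- The backward integral equation of the semigroup, with a bounded measurable integrand. -/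
theorem exists_semigroup_eq [Countable X] {f : X → ℝ} {C : ℝ} (hf : ∀ x, f x ∈ Icc 0 C) (x : X) :
    ∃ G : ℝ → ℝ, Measurable G ∧ (∀ r, G r ∈ Icc 0 (M1 k x * C)) ∧
      (∀ r, G r = ∑' z, rate k x z * semigroup k (max r 0) f z) ∧
      ∀ t, 0 ≤ t → semigroup k t f x =
        Real.exp (k x x * t) * (f x + ∫ r in (0 : ℝ)..t, Real.exp (-(k x x * r)) * G r) := by
  set F : X → ℝ≥0∞ := fun y => ENNReal.ofReal (f y) with hF
  -- The semigroup is controlled only at nonnegative times; replacing r by `max r 0` makes the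
  -- integrand bounded on the whole line.
  have hS : ∀ r z, semigroup k (max r 0) f z ∈ Icc 0 C := fun r z =>
    h.semigroup_mem_Icc hf (le_max_right _ _) z
  have hSa : ∀ r z, |semigroup k (max r 0) f z| ≤ C := fun r z => by
    rw [abs_of_nonneg (hS r z).1]; exact (hS r z).2
  set G : ℝ → ℝ := fun r => ∑' z, rate k x z * semigroup k (max r 0) f z with hG
  have hGmem : ∀ r, G r ∈ Icc 0 (M1 k x * C) := fun r => h.tsum_rate_mul_mem_Icc (hS r) x
  have hGE : ∀ r, ∑' z, ENNReal.ofReal (rate k x z) * semigroupE k (max r 0) F z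
      = ENNReal.ofReal (G r) := by
    intro r
    rw [hG, ENNReal.ofReal_tsum_of_nonneg
      (fun z => mul_nonneg (h.rate_nonneg x z) (hS r z).1) (h.summable_rate_mul (hSa r) x)]
    refine tsum_congr fun z => ?_
    rw [ENNReal.ofReal_mul (h.rate_nonneg x z), h.semigroupE_ofReal hf (le_max_right _ _)]
  have hGm : Measurable G := by
    have h1 : G = fun r => (∑' z, ENNReal.ofReal (rate k x z) *
        semigroupE k (max r 0) F z).toReal := by
      funext r
      rw [hGE, ENNReal.toReal_ofReal (hGmem r).1]
    rw [h1]
    refine Measurable.ennreal_toReal (Measurable.tsum fun z => ?_)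
    exact ((measurable_semigroupE k F z).comp (measurable_id.max measurable_const)).const_mul _
  refine ⟨G, hGm, hGmem, fun r => rfl, fun t ht => ?_⟩
  have hint : IntegrableOn (fun s => Real.exp (k x x * s) * G (t - s)) (Ioc 0 t) := by
    refine Measure.integrableOn_of_bounded (M := Real.exp (|k x x| * t) * (M1 k x * C))
      (by simp) ?_ ?_
    · exact (Measurable.mul (by fun_prop)
        (hGm.comp (measurable_const.sub measurable_id))).aestronglyMeasurable
    · refine (ae_restrict_mem measurableSet_Ioc).mono fun s hs => ?_
      rw [norm_mul, Real.norm_of_nonneg (Real.exp_pos _).le, Real.norm_of_nonneg (hGmem _).1]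
      refine mul_le_mul (Real.exp_le_exp.2 ?_) (hGmem _).2 (hGmem _).1 (Real.exp_pos _).le
      calc k x x * s ≤ |k x x| * s := mul_le_mul_of_nonneg_right (le_abs_self _) hs.1.le
        _ ≤ |k x x| * t := mul_le_mul_of_nonneg_left hs.2 (abs_nonneg _)
  have hnn : ∀ s, 0 ≤ Real.exp (k x x * s) * G (t - s) := fun s =>
    mul_nonneg (Real.exp_pos _).le (hGmem _).1
  have key : ENNReal.ofReal (semigroup k t f x) = ENNReal.ofReal (Real.exp (k x x * t) * f x
      + ∫ s in (0 : ℝ)..t, Real.exp (k x x * s) * G (t - s)) := by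
    rw [← h.semigroupE_ofReal hf ht, semigroupE_eq, intervalIntegral.integral_of_le ht,
      ENNReal.ofReal_add (mul_nonneg (Real.exp_pos _).le (hf x).1)
        (integral_nonneg hnn), ENNReal.ofReal_mul (Real.exp_pos _).le,
      ofReal_integral_eq_lintegral_ofReal hint (ae_of_all _ hnn)]
    congr 1
    refine setLIntegral_congr_fun measurableSet_Ioc fun s hs => ?_
    rw [ENNReal.ofReal_mul (Real.exp_pos _).le, ← hGE, max_eq_left (by linarith [hs.2])]
  rw [ENNReal.ofReal_eq_ofReal_iff (h.semigroup_mem_Icc hf ht x).1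
    (add_nonneg (mul_nonneg (Real.exp_pos _).le (hf x).1)
      (intervalIntegral.integral_nonneg ht fun s _ => hnn s))] at key
  rw [key, mul_add, ← intervalIntegral.integral_const_mul]
  congr 1
  -- The substitution r = t - s leaves t only in an exponential prefactor and in the upper limit,
  -- the form suited to differentiation.
  have := intervalIntegral.integral_comp_sub_left (a := 0) (b := t)
    (fun r => Real.exp (k x x * (t - r)) * G r) t
  simp only [sub_sub_cancel, sub_self, sub_zero] at this
  rw [this]
  refine intervalIntegral.integral_congr fun r _ => ?_
  rw [← mul_assoc, ← Real.exp_add]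
  ring_nf

theorem semigroup_zero [Countable X] {f : X → ℝ} {C : ℝ} (hf : ∀ x, f x ∈ Icc 0 C) :
    semigroup k 0 f = f := by
  funext x
  obtain ⟨G, -, -, -, hG⟩ := h.exists_semigroup_eq hf x
  simpa using hG 0 le_rfl

/-- First half of a bootstrap: a bounded measurable integrand has a continuous primitive. Continuity
then passes to the integrand itself, which makes the primitive differentiable. -/
theorem continuous_semigroup [Countable X] {f : X → ℝ} {C : ℝ} (hf : ∀ x, f x ∈ Icc 0 C)
    (x : X) : Continuous (fun t => semigroup k (max t 0) f x) := by
  obtain ⟨G, hm, hb, -, hG⟩ := h.exists_semigroup_eq hf x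
  have h1 : (fun t => semigroup k (max t 0) f x) = fun t => Real.exp (k x x * (max t 0)) *
      (f x + ∫ r in (0 : ℝ)..(max t 0), Real.exp (-(k x x * r)) * G r) :=
    funext fun t => hG _ (le_max_right _ _)
  rw [h1]
  have hint : ∀ a b, IntervalIntegrable (fun r => Real.exp (-(k x x * r)) * G r) volume a b := by
    intro a b
    have hGi : IntervalIntegrable G volume a b := by
      rw [intervalIntegrable_iff]
      refine Measure.integrableOn_of_bounded (M := M1 k x * C) (by simp)
        hm.aestronglyMeasurable (ae_of_all _ fun r => ?_)
      rw [Real.norm_of_nonneg (hb r).1]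
      exact (hb r).2
    exact hGi.continuousOn_mul (Continuous.continuousOn (by fun_prop))
  have hc := (intervalIntegral.continuous_primitive hint 0).comp
    (continuous_id.max continuous_const : Continuous fun t : ℝ => max t 0)
  have he : Continuous fun t : ℝ => Real.exp (k x x * (max t 0)) := by fun_prop
  exact he.mul (continuous_const.add hc)

/-- The backward equation `∂ₜ P_t f = L P_t f`. -/
theorem hasDerivWithinAt_semigroup [Countable X] {f : X → ℝ} {C : ℝ}
    (hf : ∀ x, f x ∈ Icc 0 C) (x : X) {t : ℝ} (ht : 0 ≤ t) :
    HasDerivWithinAt (fun s => semigroup k s f x) (gen k (semigroup k t f) x) (Ici 0) t := by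
  obtain ⟨G, -, -, hGe, hG⟩ := h.exists_semigroup_eq hf x
  have hS : ∀ r z, semigroup k (max r 0) f z ∈ Icc 0 C := fun r z =>
    h.semigroup_mem_Icc hf (le_max_right _ _) z
  have hSa : ∀ r z, |semigroup k (max r 0) f z| ≤ C := fun r z => by
    rw [abs_of_nonneg (hS r z).1]; exact (hS r z).2
  have hGc : Continuous G := by
    rw [funext hGe]
    refine continuous_tsum (u := fun z => rate k x z * C)
      (fun z => (h.continuous_semigroup hf z).const_mul _)
      ((h.summable_rate x).mul_right C) fun z r => ?_
    rw [norm_mul, Real.norm_of_nonneg (h.rate_nonneg x z)]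
    exact mul_le_mul_of_nonneg_left (hSa r z) (h.rate_nonneg x z)
  have hc : Continuous fun r => Real.exp (-(k x x * r)) * G r :=
    Continuous.mul (by fun_prop) hGc
  have h1 : HasDerivAt (fun t => f x + ∫ r in (0 : ℝ)..t, Real.exp (-(k x x * r)) * G r)
      (Real.exp (-(k x x * t)) * G t) t :=
    (intervalIntegral.integral_hasDerivAt_right (hc.intervalIntegrable _ _)
      (hc.stronglyMeasurableAtFilter _ _) hc.continuousAt).const_add _
  have h2 : HasDerivAt (fun t => Real.exp (k x x * t)) (Real.exp (k x x * t) * (k x x * 1)) t :=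
    ((hasDerivAt_id t).const_mul (k x x)).exp
  have h3 := (h2.mul h1).hasDerivWithinAt (s := Ici 0)
  refine (h3.congr (fun s hs => hG s hs) (hG t ht)).congr_deriv ?_
  have hmax : max t 0 = t := max_eq_left ht
  rw [h.gen_eq (h.summable_rate_mul (fun z => by simpa [hmax] using hSa t z) x), hG t ht,
    hGe t, hmax, h.diag x]
  have he : Real.exp (-M1 k x * t) * Real.exp (-(-M1 k x * t)) = 1 := by
    rw [← Real.exp_add]; simp
  linear_combination (∑' z, rate k x z * semigroup k t f z) * he

end IsReversibleMarkovChain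

end Semigroup

/-! ### Edge sums, integration by parts and the Dirichlet form -/

section Energy

variable {X : Type*} {k : X → X → ℝ} {π : X → ℝ}

/-- The symmetric edge weight `k(x,y) π(x)` off the diagonal. -/
noncomputable def edgeWeight (k : X → X → ℝ) (π : X → ℝ) (q : X × X) : ℝ :=
  rate k q.1 q.2 * π q.1

/-- The Dirichlet form `ℰ(g,h) = (1/2) ∑ k(x,y) (g(y) - g(x)) (h(y) - h(x)) π(x)`. -/
noncomputable def energy (k : X → X → ℝ) (π : X → ℝ) (g h : X → ℝ) : ℝ :=
  ∑' q : X × X, edgeWeight k π q * (1 / 2 * ((g q.2 - g q.1) * (h q.2 - h q.1)))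

/-- Boundedness of a function. -/
def IsBdd (g : X → ℝ) : Prop := ∃ C, 0 ≤ C ∧ ∀ x, |g x| ≤ C

/-- Growth at most of the order of the total jump rate. -/
def RateGrowth (k : X → X → ℝ) (g : X → ℝ) : Prop :=
  ∃ C, 0 ≤ C ∧ ∀ x, |g x| ≤ C * (1 + M1 k x)

/-- Growth on edges at most of the order of the total jump rates of the two end points. -/
def EdgeGrowth (k : X → X → ℝ) (a : X × X → ℝ) : Prop :=
  ∃ C, 0 ≤ C ∧ ∀ q, |a q| ≤ C * ((1 + M1 k q.1) + (1 + M1 k q.2))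

theorem IsBdd.of_Icc {g : X → ℝ} {c C : ℝ} (hg : ∀ x, g x ∈ Icc c C) : IsBdd g :=
  ⟨max |c| |C|, (abs_nonneg c).trans (le_max_left _ _),
    fun x => abs_le_max_abs_abs (hg x).1 (hg x).2⟩

theorem IsBdd.comp_Icc {g : X → ℝ} {c C : ℝ} (hg : ∀ x, g x ∈ Icc c C) {F : ℝ → ℝ}
    (hF : ContinuousOn F (Icc c C)) : IsBdd (fun x => F (g x)) := by
  obtain ⟨A, hA⟩ := isCompact_Icc.exists_bound_of_continuousOn hF
  exact ⟨max A 0, le_max_right _ _, fun x => (hA _ (hg x)).trans (le_max_left _ _)⟩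

theorem gen_eq_tsum_rate (k : X → X → ℝ) (g : X → ℝ) (x : X) :
    gen k g x = ∑' y, rate k x y * (g y - g x) := by
  refine tsum_congr fun y => ?_
  unfold rate
  split_ifs with hxy
  · simp [hxy]
  · rfl

theorem tsum_edgeWeight_right (k : X → X → ℝ) (π : X → ℝ) (a : X × X → ℝ) (x : X) :
    ∑' y, edgeWeight k π (x, y) * a (x, y) = (∑' y, rate k x y * a (x, y)) * π x := by
  rw [← tsum_mul_right]
  exact tsum_congr fun y => by simp only [edgeWeight]; ring

theorem summable_tsum_rate {a : X × X → ℝ} (ha : Summable fun q => edgeWeight k π q * a q) :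
    Summable fun x => (∑' y, rate k x y * a (x, y)) * π x :=
  ha.prod.congr fun x => tsum_edgeWeight_right k π a x

theorem tsum_edgeWeight_eq {a : X × X → ℝ} (ha : Summable fun q => edgeWeight k π q * a q) :
    ∑' q, edgeWeight k π q * a q = ∑' x, (∑' y, rate k x y * a (x, y)) * π x := by
  rw [ha.tsum_prod]
  exact tsum_congr fun x => tsum_edgeWeight_right k π a x

theorem energy_comm (k : X → X → ℝ) (π : X → ℝ) (g f : X → ℝ) :
    energy k π g f = energy k π f g :=
  tsum_congr fun q => by ring

theorem IsBdd.mul_rateGrowth {g f : X → ℝ} (hg : IsBdd g) (hf : RateGrowth k f) :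
    RateGrowth k (fun x => g x * f x) := by
  obtain ⟨A, hA, hg⟩ := hg
  obtain ⟨B, hB, hf⟩ := hf
  refine ⟨A * B, mul_nonneg hA hB, fun x => ?_⟩
  rw [abs_mul, mul_assoc]
  exact mul_le_mul (hg x) (hf x) (abs_nonneg _) hA

theorem IsBdd.edgeGrowth_mul_sub {g f : X → ℝ} (hg : IsBdd g) (hf : RateGrowth k f) :
    EdgeGrowth k (fun q => g q.1 * (f q.2 - f q.1)) := by
  obtain ⟨A, hA, hg⟩ := hg
  obtain ⟨B, hB, hf⟩ := hf
  refine ⟨A * B, mul_nonneg hA hB, fun q => ?_⟩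
  rw [abs_mul, mul_assoc]
  refine mul_le_mul (hg _) ?_ (abs_nonneg _) hA
  have := abs_sub (f q.2) (f q.1)
  linarith [hf q.1, hf q.2]

theorem IsBdd.edgeGrowth_sub_mul_sub {g f : X → ℝ} (hg : IsBdd g) (hf : RateGrowth k f) :
    EdgeGrowth k (fun q => (g q.2 - g q.1) * (f q.2 - f q.1)) := by
  obtain ⟨A, hA, hg⟩ := hg
  obtain ⟨B, hB, hf⟩ := hf
  refine ⟨2 * A * B, by positivity, fun q => ?_⟩
  rw [abs_mul, mul_assoc]
  have h1 := abs_sub (g q.2) (g q.1)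
  have h2 := abs_sub (f q.2) (f q.1)
  exact mul_le_mul (by linarith [hg q.1, hg q.2]) (by linarith [hf q.1, hf q.2])
    (abs_nonneg _) (by positivity)

namespace IsReversibleMarkovChain

variable (h : IsReversibleMarkovChain k π)
include h

theorem edgeWeight_nonneg (q : X × X) : 0 ≤ edgeWeight k π q :=
  mul_nonneg (h.rate_nonneg _ _) (h.pi_pos _).le

theorem edgeWeight_swap (q : X × X) : edgeWeight k π q.swap = edgeWeight k π q := by
  unfold edgeWeight rate
  by_cases hq : q.1 = q.2
  · simp [hq]
  · have := h.detailed_balance q.1 q.2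
    simp only [Prod.fst_swap, Prod.snd_swap, hq, Ne.symm hq, if_false]
    linarith

theorem tsum_edgeWeight_swap (a : X × X → ℝ) :
    ∑' q, edgeWeight k π q * a q.swap = ∑' q, edgeWeight k π q * a q := by
  rw [← (Equiv.prodComm X X).tsum_eq (fun q => edgeWeight k π q * a q)]
  simp [h.edgeWeight_swap]

theorem summable_edgeWeight_swap {a : X × X → ℝ}
    (ha : Summable fun q => edgeWeight k π q * a q) :
    Summable fun q => edgeWeight k π q * a q.swap := by
  refine ((Equiv.prodComm X X).summable_iff.2 ha).congr fun q => ?_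
  simp [h.edgeWeight_swap]

theorem rateGrowth {g : X → ℝ} (hg : IsBdd g) : RateGrowth k g := by
  obtain ⟨C, hC, hg⟩ := hg
  exact ⟨C, hC, fun x => (hg x).trans (le_mul_of_one_le_right hC (by linarith [h.M1_nonneg x]))⟩

theorem edgeGrowth_mul_sub' {g f : X → ℝ} (hg : RateGrowth k g) (hf : IsBdd f) :
    EdgeGrowth k (fun q => g q.1 * (f q.2 - f q.1)) := by
  obtain ⟨A, hA, hg⟩ := hg
  obtain ⟨B, hB, hf⟩ := hf
  refine ⟨A * (2 * B), by positivity, fun q => ?_⟩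
  have h1 := hg q.1
  have h2 : |f q.2 - f q.1| ≤ 2 * B := by
    have := abs_sub (f q.2) (f q.1)
    linarith [hf q.1, hf q.2]
  have h3 := h.M1_nonneg q.1
  have h4 := h.M1_nonneg q.2
  calc |g q.1 * (f q.2 - f q.1)| ≤ (A * (1 + M1 k q.1)) * (2 * B) := by
        rw [abs_mul]; exact mul_le_mul h1 h2 (abs_nonneg _) (by positivity)
    _ = A * (2 * B) * (1 + M1 k q.1) := by ring
    _ ≤ _ := mul_le_mul_of_nonneg_left (by linarith) (by positivity)

theorem summable_rate_mul_sub {g : X → ℝ} (hg : IsBdd g) (x : X) :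
    Summable fun y => rate k x y * (g y - g x) := by
  obtain ⟨A, hA, hg⟩ := hg
  refine h.summable_rate_mul (C := 2 * A) (fun y => ?_) x
  have := abs_sub (g y) (g x)
  linarith [hg x, hg y]

theorem abs_tsum_rate_le {a : X → ℝ} {A : ℝ} (ha : ∀ y, |a y| ≤ A) (x : X) :
    |∑' y, rate k x y * a y| ≤ A * M1 k x := by
  rw [mul_comm]
  refine tsum_of_norm_bounded (f := fun y => rate k x y * a y) ((h.summable_rate x).hasSum.mul_right A) fun y => ?_
  rw [norm_mul, Real.norm_of_nonneg (h.rate_nonneg x y)]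
  exact mul_le_mul_of_nonneg_left (ha y) (h.rate_nonneg x y)

theorem abs_gen_le {g : X → ℝ} {A : ℝ} (hg : ∀ x, |g x| ≤ A) (x : X) :
    |gen k g x| ≤ 2 * A * M1 k x := by
  rw [gen_eq_tsum_rate]
  refine h.abs_tsum_rate_le (fun y => ?_) x
  have := abs_sub (g y) (g x)
  linarith [hg x, hg y]

theorem rateGrowth_gen {g : X → ℝ} (hg : IsBdd g) : RateGrowth k (gen k g) := by
  obtain ⟨A, hA, hg⟩ := hg
  refine ⟨2 * A, by positivity, fun x => (h.abs_gen_le hg x).trans ?_⟩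
  exact mul_le_mul_of_nonneg_left (by linarith) (by positivity)

variable (hM1 : Summable (fun x => M1 k x ^ 2 * π x))
include hM1

theorem summable_growth : Summable fun x => (1 + M1 k x) * M1 k x * π x := by
  refine Summable.of_nonneg_of_le (fun x => ?_) (fun x => ?_)
    (h.pi_sum.summable.add (hM1.mul_left 2))
  · have := h.M1_nonneg x
    have := (h.pi_pos x).le
    positivity
  · have := h.M1_nonneg x
    have := (h.pi_pos x).le
    nlinarith [mul_nonneg (sq_nonneg (M1 k x - 1)) this]

theorem summable_rateGrowth_mul {g : X → ℝ} (hg : RateGrowth k g) :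
    Summable fun x => g x * π x := by
  obtain ⟨C, hC, hg⟩ := hg
  refine Summable.of_norm_bounded
    ((h.pi_sum.summable.add ((h.summable_growth hM1))).mul_left C) fun x => ?_
  rw [norm_mul, Real.norm_of_nonneg (h.pi_pos x).le]
  have h1 := h.M1_nonneg x
  have h2 := (h.pi_pos x).le
  calc |g x| * π x ≤ C * (1 + M1 k x) * π x := mul_le_mul_of_nonneg_right (hg x) h2
    _ ≤ C * (1 + (1 + M1 k x) * M1 k x) * π x := by
        gcongr
        nlinarith
    _ = _ := by ring

/-- Summing the first half over y leaves (1 + M₁) M₁ π, which is summable since M₁ ∈ ℓ²(μ). The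
second half is its transpose, and the weight is symmetric. -/
theorem summable_edgeWeight_growth :
    Summable fun q : X × X => edgeWeight k π q * ((1 + M1 k q.1) + (1 + M1 k q.2)) := by
  have h1 : Summable fun q : X × X => edgeWeight k π q * (1 + M1 k q.1) := by
    have hnn : 0 ≤ fun q : X × X => edgeWeight k π q * (1 + M1 k q.1) := fun q =>
      mul_nonneg (h.edgeWeight_nonneg q) (by linarith [h.M1_nonneg q.1])
    refine (summable_prod_of_nonneg hnn).2 ⟨fun x => ?_, ?_⟩
    · exact ((h.summable_rate x).mul_right (π x)).mul_right (1 + M1 k x)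
    · refine (h.summable_growth hM1).congr fun x => ?_
      simp only [edgeWeight]
      rw [tsum_mul_right, tsum_mul_right]
      simp only [M1]
      ring
  have h2 := h.summable_edgeWeight_swap (a := fun q => 1 + M1 k q.1) h1
  refine (h1.add h2).congr fun q => ?_
  simp only [Prod.fst_swap]
  ring

theorem summable_edgeGrowth {a : X × X → ℝ} (ha : EdgeGrowth k a) :
    Summable fun q => edgeWeight k π q * a q := by
  obtain ⟨C, hC, ha⟩ := ha
  refine Summable.of_norm_bounded ((h.summable_edgeWeight_growth hM1).mul_left C) fun q => ?_
  rw [norm_mul, Real.norm_of_nonneg (h.edgeWeight_nonneg q)]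
  calc _ ≤ edgeWeight k π q * (C * ((1 + M1 k q.1) + (1 + M1 k q.2))) :=
        mul_le_mul_of_nonneg_left (ha q) (h.edgeWeight_nonneg q)
    _ = _ := by ring

theorem summable_energy {g f : X → ℝ} (hg : IsBdd g) (hf : RateGrowth k f) :
    Summable fun q : X × X =>
      edgeWeight k π q * (1 / 2 * ((g q.2 - g q.1) * (f q.2 - f q.1))) :=
  ((h.summable_edgeGrowth hM1 (hg.edgeGrowth_sub_mul_sub hf)).mul_left (1 / 2)).congr
    fun q => by ring

/-- Integration by parts. -/
theorem summable_mul_gen_of_edgeGrowth {g f : X → ℝ}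
    (hgf : EdgeGrowth k fun q => g q.1 * (f q.2 - f q.1)) :
    Summable (fun x => g x * gen k f x * π x) ∧
      ∑' x, g x * gen k f x * π x = -energy k π g f := by
  have hs := h.summable_edgeGrowth hM1 hgf
  have he : ∀ x, g x * gen k f x * π x
      = (∑' y, rate k x y * (g x * (f y - f x))) * π x := fun x => by
    rw [gen_eq_tsum_rate, ← tsum_mul_left]
    congr 1
    exact tsum_congr fun y => by ring
  refine ⟨(summable_tsum_rate hs).congr fun x => (he x).symm, ?_⟩
  rw [tsum_congr he, ← tsum_edgeWeight_eq hs]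
  have h1 := h.tsum_edgeWeight_swap (fun q => g q.1 * (f q.2 - f q.1))
  -- The series equals its transpose; the average of the two is minus the Dirichlet form.
  have h2 := h.summable_edgeWeight_swap hs
  have h3 : energy k π g f = -(1 / 2) *
      (∑' q, edgeWeight k π q * (g q.1 * (f q.2 - f q.1))
        + ∑' q : X × X, edgeWeight k π q * (g q.swap.1 * (f q.swap.2 - f q.swap.1))) := by
    rw [← hs.tsum_add h2, ← tsum_mul_left]
    refine tsum_congr fun q => ?_
    simp only [Prod.fst_swap, Prod.snd_swap]
    ring
  rw [h3, h1]
  ring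

theorem summable_mul_gen {g f : X → ℝ} (hg : IsBdd g) (hf : RateGrowth k f) :
    Summable (fun x => g x * gen k f x * π x) ∧
      ∑' x, g x * gen k f x * π x = -energy k π g f :=
  h.summable_mul_gen_of_edgeGrowth hM1 (hg.edgeGrowth_mul_sub hf)

theorem summable_mul_gen' {g f : X → ℝ} (hg : RateGrowth k g) (hf : IsBdd f) :
    Summable (fun x => g x * gen k f x * π x) ∧
      ∑' x, g x * gen k f x * π x = -energy k π g f :=
  h.summable_mul_gen_of_edgeGrowth hM1 (h.edgeGrowth_mul_sub' hg hf)

/-- `ℰ(Lg, f) = ℰ(g, Lf)` for bounded functions. -/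
theorem energy_gen_comm {g f : X → ℝ} (hg : IsBdd g) (hf : IsBdd f) :
    energy k π (gen k g) f = energy k π g (gen k f) := by
  -- Both sides equal minus the integral of Lg · Lf, whose convergence uses the square integrability
  -- of M₁.
  have h1 := (h.summable_mul_gen' hM1 (h.rateGrowth_gen hg) hf).2
  have h2 := (h.summable_mul_gen' hM1 (h.rateGrowth_gen hf) hg).2
  rw [energy_comm k π g, ← neg_inj, ← h1, ← h2]
  exact tsum_congr fun x => by ring

end IsReversibleMarkovChain

end Energy

/-! ### Calculus of Φ_p and the integral identities for Ψ and Ψ₂ -/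

section Functions

variable {p : ℝ}

theorem hasDerivAt_Phi (p : ℝ) {r : ℝ} (hr : 0 < r) : HasDerivAt (Phi p) (PhiD p r) r := by
  rw [PhiD_eq hr]
  exact ((Real.hasDerivAt_rpow_const (Or.inl hr.ne')).sub (hasDerivAt_id r)).div_const _

theorem hasDerivAt_PhiD (hp : p ∈ Ioo (1 : ℝ) 2) {r : ℝ} (hr : 0 < r) :
    HasDerivAt (PhiD p) (r ^ (p - 2)) r := by
  have h1 : HasDerivAt (fun r : ℝ => (p * r ^ (p - 1) - 1) / (p * (p - 1)))
      (p * ((p - 1) * r ^ (p - 1 - 1)) / (p * (p - 1))) r :=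
    (((Real.hasDerivAt_rpow_const (Or.inl hr.ne')).const_mul p).sub_const 1).div_const _
  have h2 : p * ((p - 1) * r ^ (p - 1 - 1)) / (p * (p - 1)) = r ^ (p - 2) := by
    have : p ≠ 0 := by linarith [hp.1]
    have : p - 1 ≠ 0 := by linarith [hp.1]
    rw [show p - 1 - 1 = p - 2 by ring]
    field_simp
  rw [h2] at h1
  refine h1.congr_of_eventuallyEq ?_
  filter_upwards [lt_mem_nhds hr] with s hs using PhiD_eq hs

/-- The dependence on Φ_p' is affine, so increments of r^(p-1) are p - 1 times those of Φ_p'. -/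
theorem rpow_sub_one_eq (hp : p ∈ Ioo (1 : ℝ) 2) {r : ℝ} (hr : 0 < r) :
    r ^ (p - 1) = (p - 1) * PhiD p r + 1 / p := by
  have : p ≠ 0 := by linarith [hp.1]
  have : p - 1 ≠ 0 := by linarith [hp.1]
  rw [PhiD_eq hr]
  field_simp
  ring

theorem PhiD_mono (hp : p ∈ Ioo (1 : ℝ) 2) {r s : ℝ} (hr : 0 < r) (hrs : r ≤ s) :
    PhiD p r ≤ PhiD p s := by
  rw [PhiD_eq hr, PhiD_eq (hr.trans_le hrs)]
  have h1 : 0 < p := by linarith [hp.1]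
  have h2 : 0 < p - 1 := by linarith [hp.1]
  gcongr

theorem mul_PhiD_sub_nonneg (hp : p ∈ Ioo (1 : ℝ) 2) {r s : ℝ} (hr : 0 < r) (hs : 0 < s) :
    0 ≤ (s - r) * (PhiD p s - PhiD p r) := by
  rcases le_total r s with hrs | hrs
  · exact mul_nonneg (sub_nonneg.2 hrs) (sub_nonneg.2 (PhiD_mono hp hr hrs))
  · exact mul_nonneg_of_nonpos_of_nonpos (sub_nonpos.2 hrs)
      (sub_nonpos.2 (PhiD_mono hp hs hrs))

theorem deriv_Upsilon (r : ℝ) : deriv Upsilon r = Real.exp r - 1 := by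
  have : HasDerivAt Upsilon (Real.exp r - 0 - 1) r :=
    ((Real.hasDerivAt_exp r).sub (hasDerivAt_const r 1)).sub (hasDerivAt_id r)
  simpa using this.deriv

variable {X : Type*} {k : X → X → ℝ} {π : X → ℝ} {f : X → ℝ} {c C : ℝ}

theorem isBdd_PhiD (hp : p ∈ Ioo (1 : ℝ) 2) (hc : 0 < c) (hf : ∀ x, f x ∈ Icc c C) :
    IsBdd fun x => PhiD p (f x) :=
  IsBdd.comp_Icc hf fun _ hr =>
    (hasDerivAt_PhiD hp (hc.trans_le hr.1)).continuousAt.continuousWithinAt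

theorem isBdd_Phi (p : ℝ) (hc : 0 < c) (hf : ∀ x, f x ∈ Icc c C) :
    IsBdd fun x => Phi p (f x) :=
  IsBdd.comp_Icc hf fun _ hr =>
    (hasDerivAt_Phi p (hc.trans_le hr.1)).continuousAt.continuousWithinAt

theorem isBdd_rpow (a : ℝ) (hc : 0 < c) (hf : ∀ x, f x ∈ Icc c C) :
    IsBdd fun x => f x ^ a :=
  IsBdd.comp_Icc (F := fun r => r ^ a) hf fun r hr =>
    (Real.continuousAt_rpow_const r a (Or.inl (hc.trans_le hr.1).ne')).continuousWithinAt

/-- Υ'(log f(y) - log f(x)) = f(y)/f(x) - 1, and the factor f(x) clears the denominator. -/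
theorem mul_BOp_eq (hf : ∀ x, 0 < f x) (g : X → ℝ) (x : X) :
    f x * BOp k (deriv Upsilon) (fun y => Real.log (f y)) g x =
      ∑' y, rate k x y * ((f y - f x) * (g y - g x)) := by
  rw [BOp, ← tsum_mul_left]
  refine tsum_congr fun y => ?_
  rw [deriv_Upsilon, Real.exp_sub, Real.exp_log (hf x), Real.exp_log (hf y), rate]
  have := (hf x).ne'
  split_ifs with hxy
  · simp [hxy]
  · field_simp

namespace IsReversibleMarkovChain

variable (h : IsReversibleMarkovChain k π)
include h

/-- The defining series splits because f and Φ_p'(f) are bounded; the coefficient is Φ_p''(f) =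
f^(p-2). -/
theorem Psi_eq (hp : p ∈ Ioo (1 : ℝ) 2) (hc : 0 < c) (hf : ∀ x, f x ∈ Icc c C) (x : X) :
    Psi k p f x = f x ^ (p - 2) * gen k f x - gen k (fun y => PhiD p (f y)) x := by
  have h1 := h.summable_rate_mul_sub (isBdd_PhiD hp hc hf) x
  have h2 := h.summable_rate_mul_sub (IsBdd.of_Icc hf) x
  rw [Psi, LamBar, gen_eq_tsum_rate, gen_eq_tsum_rate, ← tsum_mul_left,
    ← (h2.mul_left _).tsum_sub h1, ← tsum_neg]
  refine tsum_congr fun y => ?_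
  rw [Lam, (hasDerivAt_PhiD hp (hc.trans_le (hf x).1)).deriv, rate]
  split_ifs with hxy
  · simp [hxy]
  · ring

theorem rateGrowth_Psi (hp : p ∈ Ioo (1 : ℝ) 2) (hc : 0 < c) (hf : ∀ x, f x ∈ Icc c C) :
    RateGrowth k (Psi k p f) := by
  obtain ⟨A, hA, h1⟩ := IsBdd.mul_rateGrowth (isBdd_rpow (p - 2) hc hf)
    (h.rateGrowth_gen (IsBdd.of_Icc hf))
  obtain ⟨B, hB, h2⟩ := h.rateGrowth_gen (isBdd_PhiD hp hc hf)
  refine ⟨A + B, by positivity, fun x => ?_⟩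
  rw [h.Psi_eq hp hc hf]
  have := abs_sub (f x ^ (p - 2) * gen k f x) (gen k (fun y => PhiD p (f y)) x)
  linarith [h1 x, h2 x]

theorem energy_PhiD_nonneg (hp : p ∈ Ioo (1 : ℝ) 2) (hf : ∀ x, 0 < f x) :
    0 ≤ energy k π f (fun x => PhiD p (f x)) :=
  tsum_nonneg fun q => mul_nonneg (h.edgeWeight_nonneg q)
    (mul_nonneg (by norm_num) (mul_PhiD_sub_nonneg hp (hf _) (hf _)))

variable (hM1 : Summable (fun x => M1 k x ^ 2 * π x))
include hM1

theorem summable_mul_Psi (hp : p ∈ Ioo (1 : ℝ) 2) (hc : 0 < c) (hf : ∀ x, f x ∈ Icc c C) :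
    Summable fun x => f x * Psi k p f x * π x :=
  h.summable_rateGrowth_mul hM1
    (IsBdd.mul_rateGrowth (IsBdd.of_Icc hf) (h.rateGrowth_Psi hp hc hf))

/-- f Ψ(f) = f^(p-1) Lf - f L(Φ_p'(f)). Integrating by parts, the two terms contribute -(p-1) and +1
times the energy, and the total 2 - p cancels the normalisation. -/
theorem fisher_eq_energy (hp : p ∈ Ioo (1 : ℝ) 2) (hc : 0 < c) (hf : ∀ x, f x ∈ Icc c C) :
    fisher k π p f = energy k π f (fun x => PhiD p (f x)) := by
  have hfb := IsBdd.of_Icc hf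
  have hφ := isBdd_PhiD hp hc hf
  obtain ⟨s1, e1⟩ := h.summable_mul_gen hM1 hfb (h.rateGrowth hφ)
  obtain ⟨s2, e2⟩ := h.summable_mul_gen hM1 (isBdd_rpow (p - 1) hc hf) (h.rateGrowth hfb)
  have h3 : energy k π (fun x => f x ^ (p - 1)) f
      = (p - 1) * energy k π f (fun x => PhiD p (f x)) := by
    rw [energy, energy, ← tsum_mul_left]
    refine tsum_congr fun q => ?_
    rw [rpow_sub_one_eq hp (hc.trans_le (hf _).1), rpow_sub_one_eq hp (hc.trans_le (hf _).1)]
    ring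
  have h4 : integ π (fun x => f x * Psi k p f x)
      = (2 - p) * energy k π f (fun x => PhiD p (f x)) := by
    have : integ π (fun x => f x * Psi k p f x) = ∑' x, f x ^ (p - 1) * gen k f x * π x
        - ∑' x, f x * gen k (fun y => PhiD p (f y)) x * π x := by
      rw [← s2.tsum_sub s1]
      refine tsum_congr fun x => ?_
      have hx := hc.trans_le (hf x).1
      dsimp only
      rw [h.Psi_eq hp hc hf, show p - 1 = 1 + (p - 2) by ring, Real.rpow_add hx, Real.rpow_one]
      ring
    rw [this, e1, e2, h3]
    ring
  rw [fisher, h4]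
  have : 2 - p ≠ 0 := by linarith [hp.2]
  field_simp

theorem fisherExt_eq_energy (hp : p ∈ Ioo (1 : ℝ) 2) (hc : 0 < c) (hf : ∀ x, f x ∈ Icc c C) :
    fisherExt k π p f = ENNReal.ofReal (energy k π f (fun x => PhiD p (f x))) := by
  have hs := h.summable_energy hM1 (IsBdd.of_Icc hf) (h.rateGrowth (isBdd_PhiD hp hc hf))
  rw [energy, ENNReal.ofReal_tsum_of_nonneg (fun q => ?_) hs, ENNReal.tsum_prod', fisherExt]
  · refine tsum_congr fun x => tsum_congr fun y => ?_
    rw [edgeWeight, rate]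
    split_ifs with hxy
    · simp only [] at hxy
      simp [hxy]
    · ring_nf
  · refine mul_nonneg (h.edgeWeight_nonneg q) (mul_nonneg (by norm_num) ?_)
    exact mul_PhiD_sub_nonneg hp (hc.trans_le (hf _).1) (hc.trans_le (hf _).1)

/-- The right-hand side is minus the formal time derivative of the energy. The L Ψ term gives -E(f,
Ψ(f)), the B term gives 2 E(f, Lφ) with φ = Φ_p'(f), and self-adjointness turns the remaining E(f,
Lφ) into E(Lf, φ). -/
theorem integ_mul_Psi2 (hp : p ∈ Ioo (1 : ℝ) 2) (hc : 0 < c) (hf : ∀ x, f x ∈ Icc c C) :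
    Summable (fun x => f x * Psi2 k p f x * π x) ∧
    2 * integ π (fun x => f x * Psi2 k p f x) =
      -(energy k π (gen k f) (fun x => PhiD p (f x))
        + energy k π f (fun x => f x ^ (p - 2) * gen k f x)) := by
  have hpos : ∀ x, 0 < f x := fun x => hc.trans_le (hf x).1
  have hfb := IsBdd.of_Icc hf
  have hφ := isBdd_PhiD hp hc hf
  set φ : X → ℝ := fun x => PhiD p (f x) with hφd
  have hLφ := h.rateGrowth_gen hφ
  have hfL := IsBdd.mul_rateGrowth (isBdd_rpow (p - 2) hc hf) (h.rateGrowth_gen hfb)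
  obtain ⟨s1, e1⟩ := h.summable_mul_gen hM1 hfb (h.rateGrowth_Psi hp hc hf)
  have sB := h.summable_edgeGrowth hM1 (hfb.edgeGrowth_sub_mul_sub hLφ)
  have s2 := summable_tsum_rate sB
  have e2 := tsum_edgeWeight_eq sB
  have hx : ∀ x, f x * Psi2 k p f x * π x = 1 / 2 * (f x * gen k (Psi k p f) x * π x
      - (∑' y, rate k x y * ((f y - f x) * (gen k φ y - gen k φ x))) * π x) := fun x => by
    rw [← mul_BOp_eq hpos, Psi2]
    ring
  refine ⟨((s1.sub s2).mul_left (1 / 2)).congr fun x => (hx x).symm, ?_⟩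
  have e3 : ∑' q, edgeWeight k π q * ((f q.2 - f q.1) * (gen k φ q.2 - gen k φ q.1))
      = 2 * energy k π f (gen k φ) := by
    rw [energy, ← tsum_mul_left]
    exact tsum_congr fun q => by ring
  have e4 : energy k π f (Psi k p f) = energy k π f (fun x => f x ^ (p - 2) * gen k f x)
      - energy k π f (gen k φ) := by
    rw [energy, energy, energy, ← (h.summable_energy hM1 hfb hfL).tsum_sub
      (h.summable_energy hM1 hfb hLφ)]
    refine tsum_congr fun q => ?_
    rw [h.Psi_eq hp hc hf, h.Psi_eq hp hc hf]
    ring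
  rw [integ, tsum_congr hx, tsum_mul_left, s1.tsum_sub s2, ← e2, e1, e3, e4,
    h.energy_gen_comm hM1 hfb hφ]
  ring

end IsReversibleMarkovChain

end Functions

/-! ### Differentiating mass, entropy and energy along the semigroup -/

/-- Termwise differentiation of a series within a convex set, with a summable bound for the
derivatives. -/
theorem hasDerivWithinAt_tsum_of_bounded {ι : Type*} {F F' : ι → ℝ → ℝ} {b : ι → ℝ}
    (hb : Summable b) {s : Set ℝ} (hs : Convex ℝ s)
    (hF : ∀ i, ∀ t ∈ s, HasDerivWithinAt (F i) (F' i t) s t)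
    (hbd : ∀ i, ∀ t ∈ s, |F' i t| ≤ b i) (hsum : ∀ t ∈ s, Summable fun i => F i t)
    {t : ℝ} (ht : t ∈ s) :
    HasDerivWithinAt (fun r => ∑' i, F i r) (∑' i, F' i t) s t := by
  rw [hasDerivWithinAt_iff_tendsto_slope]
  have h1 : Tendsto (fun r => ∑' i, slope (F i) t r) (𝓝[s \ {t}] t) (𝓝 (∑' i, F' i t)) := by
    refine tendsto_tsum_of_dominated_convergence hb
      (fun i => hasDerivWithinAt_iff_tendsto_slope.1 (hF i t ht)) ?_
    filter_upwards [self_mem_nhdsWithin] with r hr i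
    have hne : 0 < ‖r - t‖ := norm_pos_iff.2 (sub_ne_zero.2 hr.2)
    -- The mean value inequality bounds the difference quotients by the same summable sequence, so
    -- dominated convergence applies.
    have := hs.norm_image_sub_le_of_norm_hasDerivWithin_le (hF i) (hbd i) ht hr.1
    rw [slope_def_field, norm_div]
    exact (div_le_iff₀ hne).2 this
  refine h1.congr' ?_
  filter_upwards [self_mem_nhdsWithin] with r hr
  rw [slope_def_field, ← (hsum r hr.1).tsum_sub (hsum t ht), ← tsum_div_const]
  exact tsum_congr fun i => slope_def_field _ _ _

/-- Scalar estimate for the time derivative of one edge term: φ, ψ and l stand for Φ_p'(u), u^(p-2)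
and Lu at the two end points, and m for 1 + M₁. The constant does not depend on time. -/
theorem abs_energy_deriv_le {u₁ u₂ φ₁ φ₂ ψ₁ ψ₂ l₁ l₂ c C A B m₁ m₂ : ℝ}
    (h₁ : u₁ ∈ Icc c C) (h₂ : u₂ ∈ Icc c C) (hc : 0 < c) (a₁ : |φ₁| ≤ A) (a₂ : |φ₂| ≤ A)
    (b₁ : |ψ₁| ≤ B) (b₂ : |ψ₂| ≤ B) (hl₁ : |l₁| ≤ 2 * C * m₁) (hl₂ : |l₂| ≤ 2 * C * m₂)
    (hm : 0 ≤ m₁ + m₂) :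
    |1 / 2 * ((l₂ - l₁) * (φ₂ - φ₁) + (u₂ - u₁) * (ψ₂ * l₂ - ψ₁ * l₁))|
      ≤ (2 * C * A + 2 * C * B * C) * (m₁ + m₂) := by
  have hC : 0 ≤ C := hc.le.trans (h₁.1.trans h₁.2)
  have hA0 : 0 ≤ A := (abs_nonneg _).trans a₁
  have hB0 : 0 ≤ B := (abs_nonneg _).trans b₁
  have e1 : |l₂ - l₁| ≤ 2 * C * (m₁ + m₂) := by
    have := abs_sub l₂ l₁
    linarith
  have e2 : |φ₂ - φ₁| ≤ 2 * A := by
    have := abs_sub φ₂ φ₁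
    linarith
  have e3 : |u₂ - u₁| ≤ C := by
    rw [abs_le]
    constructor <;> linarith [h₁.1, h₁.2, h₂.1, h₂.2]
  have e4 : |ψ₂ * l₂ - ψ₁ * l₁| ≤ B * (2 * C * (m₁ + m₂)) := by
    have := abs_sub (ψ₂ * l₂) (ψ₁ * l₁)
    rw [abs_mul, abs_mul] at this
    have := mul_le_mul b₁ hl₁ (abs_nonneg _) hB0
    have := mul_le_mul b₂ hl₂ (abs_nonneg _) hB0
    linarith
  have m1 := mul_le_mul e1 e2 (abs_nonneg _) (by positivity)
  have m2 := mul_le_mul e3 e4 (abs_nonneg _) hC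
  rw [abs_mul, abs_of_pos (by norm_num : (0 : ℝ) < 1 / 2)]
  have h3 := abs_add_le ((l₂ - l₁) * (φ₂ - φ₁)) ((u₂ - u₁) * (ψ₂ * l₂ - ψ₁ * l₁))
  rw [abs_mul, abs_mul] at h3
  have : 0 ≤ C * B * C * (m₁ + m₂) := by positivity
  linarith

section Flow

variable {X : Type*} [Countable X] {k : X → X → ℝ} {π : X → ℝ} {f : X → ℝ} {c C p : ℝ}

namespace IsReversibleMarkovChain

variable (h : IsReversibleMarkovChain k π)
include h

omit [Countable X] in
theorem summable_bdd_mul {g : X → ℝ} (hg : IsBdd g) : Summable fun x => g x * π x := by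
  obtain ⟨A, hA, hg⟩ := hg
  refine Summable.of_norm_bounded (h.pi_sum.summable.mul_left A) fun x => ?_
  rw [norm_mul, Real.norm_of_nonneg (h.pi_pos x).le]
  exact mul_le_mul_of_nonneg_right (hg x) (h.pi_pos x).le

omit [Countable X] in
theorem abs_gen_semigroup_le (hc : 0 < c) (hf : ∀ x, f x ∈ Icc c C) {t : ℝ} (ht : 0 ≤ t)
    (x : X) : |gen k (semigroup k t f) x| ≤ 2 * C * (1 + M1 k x) := by
  have hu := h.semigroup_mem_Icc hf ht
  have h1 : ∀ x, |semigroup k t f x| ≤ C := fun x => by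
    rw [abs_of_nonneg (hc.le.trans (hu x).1)]
    exact (hu x).2
  refine (h.abs_gen_le h1 x).trans ?_
  have : 0 ≤ C := hc.le.trans ((hf x).1.trans (hf x).2)
  nlinarith

theorem hasDerivWithinAt_semigroup_of_Icc (hc : 0 < c) (hf : ∀ x, f x ∈ Icc c C) (x : X)
    {t : ℝ} (ht : 0 ≤ t) :
    HasDerivWithinAt (fun s => semigroup k s f x) (gen k (semigroup k t f) x) (Ici 0) t :=
  h.hasDerivWithinAt_semigroup (fun x => ⟨hc.le.trans (hf x).1, (hf x).2⟩) x ht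

variable (hM1 : Summable (fun x => M1 k x ^ 2 * π x))
include hM1

/-- Conservation of mass. -/
theorem hasSum_semigroup_mul (hc : 0 < c) (hf : ∀ x, f x ∈ Icc c C)
    (hsum : HasSum (fun x => f x * π x) 1) {t : ℝ} (ht : 0 ≤ t) :
    HasSum (fun x => semigroup k t f x * π x) 1 := by
  have hb : ∀ s ∈ Ici (0 : ℝ), IsBdd (semigroup k s f) := fun s hs =>
    IsBdd.of_Icc (h.semigroup_mem_Icc hf hs)
  have hone : IsBdd (fun _ : X => (1 : ℝ)) := ⟨1, zero_le_one, fun _ => by simp⟩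
  have hd : ∀ s ∈ Ici (0 : ℝ), HasDerivWithinAt (fun r => ∑' x, semigroup k r f x * π x) 0
      (Ici 0) s := by
    intro s hs
    -- The integral of Lu is -E(1,u), and constants have no increments.
    have h0 : ∑' x, gen k (semigroup k s f) x * π x = 0 := by
      have := (h.summable_mul_gen hM1 hone (h.rateGrowth (hb s hs))).2
      simpa [energy] using this
    refine HasDerivWithinAt.congr_deriv (hasDerivWithinAt_tsum_of_bounded
      (F := fun x r => semigroup k r f x * π x)
      (F' := fun x r => gen k (semigroup k r f) x * π x)
      (b := fun x => 2 * C * (1 + M1 k x) * π x) ?_ (convex_Ici 0)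
      (fun x r hr => (h.hasDerivWithinAt_semigroup_of_Icc hc hf x hr).mul_const _)
      (fun x r hr => ?_) (fun r hr => h.summable_bdd_mul (hb r hr)) hs) h0
    · refine h.summable_rateGrowth_mul hM1 ⟨2 * |C|, by positivity, fun x => ?_⟩
      rw [abs_mul, abs_mul, abs_two, abs_of_nonneg (by linarith [h.M1_nonneg x] : 0 ≤ 1 + M1 k x)]
    · rw [abs_mul, abs_of_pos (h.pi_pos x)]
      exact mul_le_mul_of_nonneg_right (h.abs_gen_semigroup_le hc hf hr x) (h.pi_pos x).le
  have h1 := (convex_Ici (0 : ℝ)).norm_image_sub_le_of_norm_hasDerivWithin_le (C := 0) hd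
    (fun _ _ => by simp) (mem_Ici.2 le_rfl) (mem_Ici.2 ht)
  rw [zero_mul, norm_le_zero_iff, sub_eq_zero,
    h.semigroup_zero (fun x => ⟨hc.le.trans (hf x).1, (hf x).2⟩), hsum.tsum_eq] at h1
  rw [← h1]
  exact (h.summable_bdd_mul (hb t ht)).hasSum

theorem hasDerivWithinAt_entropy (hp : p ∈ Ioo (1 : ℝ) 2) (hc : 0 < c)
    (hf : ∀ x, f x ∈ Icc c C) {t : ℝ} (ht : 0 ≤ t) :
    HasDerivWithinAt (fun s => entropy π p (semigroup k s f))
      (-energy k π (semigroup k t f) (fun x => PhiD p (semigroup k t f x))) (Ici 0) t := by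
  have hu : ∀ s, 0 ≤ s → ∀ x, semigroup k s f x ∈ Icc c C := fun s hs =>
    h.semigroup_mem_Icc hf hs
  obtain ⟨A, hA⟩ := isCompact_Icc.exists_bound_of_continuousOn
    (f := PhiD p) (s := Icc c C) fun r hr =>
      (hasDerivAt_PhiD hp (hc.trans_le hr.1)).continuousAt.continuousWithinAt
  rw [energy_comm, ← (h.summable_mul_gen hM1 (isBdd_PhiD hp hc (hu t ht))
    (h.rateGrowth (IsBdd.of_Icc (hu t ht)))).2]
  refine hasDerivWithinAt_tsum_of_bounded (F := fun x r => Phi p (semigroup k r f x) * π x)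
    (F' := fun x r => PhiD p (semigroup k r f x) * gen k (semigroup k r f) x * π x)
    (b := fun x => A * (2 * C) * (1 + M1 k x) * π x) ?_ (convex_Ici 0)
    (fun x r hr => ?_) (fun x r hr => ?_)
    (fun r hr => h.summable_bdd_mul (isBdd_Phi p hc (hu r hr))) ht
  · refine h.summable_rateGrowth_mul hM1 ⟨|A * (2 * C)|, abs_nonneg _, fun x => ?_⟩
    rw [abs_mul, abs_of_nonneg (by linarith [h.M1_nonneg x] : 0 ≤ 1 + M1 k x)]
  · exact ((hasDerivAt_Phi p (hc.trans_le (hu r hr x).1)).comp_hasDerivWithinAt r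
      (h.hasDerivWithinAt_semigroup_of_Icc hc hf x hr)).mul_const _
  · have hA' := hA _ (hu r hr x)
    rw [abs_mul, abs_mul, abs_of_pos (h.pi_pos x), mul_assoc A]
    refine mul_le_mul_of_nonneg_right ?_ (h.pi_pos x).le
    exact mul_le_mul hA' (h.abs_gen_semigroup_le hc hf hr x) (abs_nonneg _)
      ((norm_nonneg _).trans hA')

/-- The product rule on each edge, with ∂ₜ Φ_p'(u) = u^(p-2) Lu, produces the two energies of
`integ_mul_Psi2`. -/
theorem hasDerivWithinAt_energy (hp : p ∈ Ioo (1 : ℝ) 2) (hc : 0 < c)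
    (hf : ∀ x, f x ∈ Icc c C) {t : ℝ} (ht : 0 ≤ t) :
    HasDerivWithinAt
      (fun s => energy k π (semigroup k s f) (fun x => PhiD p (semigroup k s f x)))
      (-(2 * integ π (fun x => semigroup k t f x * Psi2 k p (semigroup k t f) x)))
      (Ici 0) t := by
  have hu : ∀ s, 0 ≤ s → ∀ x, semigroup k s f x ∈ Icc c C := fun s hs =>
    h.semigroup_mem_Icc hf hs
  have hub : ∀ s, 0 ≤ s → IsBdd (semigroup k s f) := fun s hs => IsBdd.of_Icc (hu s hs)
  obtain ⟨A, hA⟩ := isCompact_Icc.exists_bound_of_continuousOn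
    (f := PhiD p) (s := Icc c C) fun r hr =>
      (hasDerivAt_PhiD hp (hc.trans_le hr.1)).continuousAt.continuousWithinAt
  obtain ⟨B, hB⟩ := isCompact_Icc.exists_bound_of_continuousOn
    (f := fun r : ℝ => r ^ (p - 2)) (s := Icc c C) fun r hr =>
      (Real.continuousAt_rpow_const r _ (Or.inl (hc.trans_le hr.1).ne')).continuousWithinAt
  have hφ := isBdd_PhiD hp hc (hu t ht)
  have hL := h.rateGrowth_gen (hub t ht)
  have s1 := h.summable_energy hM1 hφ hL
  have s2 := h.summable_energy hM1 (hub t ht)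
    (IsBdd.mul_rateGrowth (isBdd_rpow (p - 2) hc (hu t ht)) hL)
  rw [(h.integ_mul_Psi2 hM1 hp hc (hu t ht)).2, neg_neg,
    energy_comm k π (gen k (semigroup k t f)), energy, energy, ← s1.tsum_add s2]
  set F' : X × X → ℝ → ℝ := fun q r => edgeWeight k π q * (1 / 2 *
      ((gen k (semigroup k r f) q.2 - gen k (semigroup k r f) q.1) *
        (PhiD p (semigroup k r f q.2) - PhiD p (semigroup k r f q.1))
      + (semigroup k r f q.2 - semigroup k r f q.1) *
        (semigroup k r f q.2 ^ (p - 2) * gen k (semigroup k r f) q.2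
          - semigroup k r f q.1 ^ (p - 2) * gen k (semigroup k r f) q.1))) with hF'
  set b : X × X → ℝ := fun q => edgeWeight k π q *
      ((2 * C * A + 2 * C * B * C) * ((1 + M1 k q.1) + (1 + M1 k q.2))) with hb
  have hbs : Summable b := by
    refine h.summable_edgeGrowth hM1 ⟨|2 * C * A + 2 * C * B * C|, abs_nonneg _, fun q => ?_⟩
    rw [abs_mul, abs_of_nonneg
      (by linarith [h.M1_nonneg q.1, h.M1_nonneg q.2] : 0 ≤ (1 + M1 k q.1) + (1 + M1 k q.2))]
  have hd : ∀ q : X × X, ∀ r ∈ Ici (0 : ℝ), HasDerivWithinAt (fun r => edgeWeight k π q *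
      (1 / 2 * ((semigroup k r f q.2 - semigroup k r f q.1) *
      (PhiD p (semigroup k r f q.2) - PhiD p (semigroup k r f q.1))))) (F' q r) (Ici 0) r := by
    intro q r hr
    have hd := fun x => h.hasDerivWithinAt_semigroup_of_Icc hc hf x hr
    have hdφ : ∀ x, HasDerivWithinAt (fun s => PhiD p (semigroup k s f x))
        (semigroup k r f x ^ (p - 2) * gen k (semigroup k r f) x) (Ici 0) r := fun x =>
      (hasDerivAt_PhiD hp (hc.trans_le (hu r hr x).1)).comp_hasDerivWithinAt r (hd x)
    exact ((((hd q.2).fun_sub (hd q.1)).fun_mul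
      ((hdφ q.2).fun_sub (hdφ q.1))).const_mul _).const_mul _
  have hbd : ∀ q, ∀ r ∈ Ici (0 : ℝ), |F' q r| ≤ b q := by
    intro q r hr
    rw [hF', hb]
    dsimp only
    rw [abs_mul, abs_of_nonneg (h.edgeWeight_nonneg q)]
    refine mul_le_mul_of_nonneg_left ?_ (h.edgeWeight_nonneg q)
    have u1 := hu r hr q.1
    have u2 := hu r hr q.2
    exact abs_energy_deriv_le u1 u2 hc (hA _ u1) (hA _ u2) (hB _ u1) (hB _ u2)
      (h.abs_gen_semigroup_le hc hf hr q.1) (h.abs_gen_semigroup_le hc hf hr q.2)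
      (by linarith [h.M1_nonneg q.1, h.M1_nonneg q.2])
  have key := hasDerivWithinAt_tsum_of_bounded hbs (convex_Ici 0) hd hbd (fun r hr =>
    h.summable_energy hM1 (g := semigroup k r f) (f := fun x => PhiD p (semigroup k r f x))
      (hub r hr) (h.rateGrowth (isBdd_PhiD hp hc (hu r hr)))) ht
  refine HasDerivWithinAt.congr_deriv (f := fun s => energy k π (semigroup k s f)
    (fun x => PhiD p (semigroup k s f x))) key (tsum_congr fun q => ?_)
  simp only [hF']
  ring

end IsReversibleMarkovChain

end Flow

/-! ### Decay, convergence to equilibrium and the inequality for densities in [c,C] -/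

section Decay

variable {X : Type*} [Countable X] {k : X → X → ℝ} {π : X → ℝ} {f : X → ℝ} {c C p κ : ℝ}

/-- Since p < 2, the derivative z^(p-2) of Φ_p' is decreasing and is at least C^(p-2) up to C. -/
theorem mul_sub_le_PhiD_sub (hp : p ∈ Ioo (1 : ℝ) 2) {r s : ℝ} (hr : 0 < r) (hrs : r ≤ s)
    (hs : s ≤ C) : C ^ (p - 2) * (s - r) ≤ PhiD p s - PhiD p r := by
  have hpos : ∀ z ∈ Icc r s, 0 < z := fun z hz => hr.trans_le hz.1
  refine (convex_Icc r s).mul_sub_le_image_sub_of_le_deriv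
    (fun z hz => (hasDerivAt_PhiD hp (hpos z hz)).continuousAt.continuousWithinAt)
    (fun z hz => (hasDerivAt_PhiD hp (hpos z
      (interior_subset hz))).differentiableAt.differentiableWithinAt) (fun z hz => ?_)
    r (left_mem_Icc.2 hrs) s (right_mem_Icc.2 hrs) hrs
  have hz' := interior_subset hz
  rw [(hasDerivAt_PhiD hp (hpos z hz')).deriv]
  exact Real.rpow_le_rpow_of_nonpos (hpos z hz') (hz'.2.trans hs) (by linarith [hp.2])

theorem mul_sq_le_mul_PhiD_sub (hp : p ∈ Ioo (1 : ℝ) 2) {r s : ℝ} (hr : r ∈ Ioc 0 C)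
    (hs : s ∈ Ioc 0 C) : C ^ (p - 2) * (s - r) ^ 2 ≤ (s - r) * (PhiD p s - PhiD p r) := by
  rcases le_total r s with hrs | hrs
  · have := mul_sub_le_PhiD_sub hp hr.1 hrs hs.2
    nlinarith [sub_nonneg.2 hrs]
  · have := mul_sub_le_PhiD_sub hp hs.1 hrs hr.2
    nlinarith [sub_nonneg.2 hrs]

namespace IsReversibleMarkovChain

variable (h : IsReversibleMarkovChain k π) (hM1 : Summable (fun x => M1 k x ^ 2 * π x))
include h hM1

omit [Countable X] in
/-- The integrated curvature-dimension condition. -/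
theorem mul_energy_le_of_CD (hp : p ∈ Ioo (1 : ℝ) 2) (hCD : CD k p κ) (hc : 0 < c)
    (hf : ∀ x, f x ∈ Icc c C) :
    2 * κ * energy k π f (fun x => PhiD p (f x)) ≤ 2 * integ π (fun x => f x * Psi2 k p f x) := by
  have h2 : 0 < 2 - p := by linarith [hp.2]
  have hmem : f ∈ LinftyPos X := by
    obtain ⟨A, -, hA⟩ := IsBdd.of_Icc hf
    exact ⟨⟨A, hA⟩, c, hc, fun x => (hf x).1⟩
  have hle : κ / (2 - p) * ∑' x, f x * Psi k p f x * π x ≤ ∑' x, f x * Psi2 k p f x * π x := by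
    rw [← tsum_mul_left]
    refine ((h.summable_mul_Psi hM1 hp hc hf).mul_left _).tsum_le_tsum (fun x => ?_)
      (h.integ_mul_Psi2 hM1 hp hc hf).1
    have := mul_le_mul_of_nonneg_left (hCD x f hmem)
      (mul_nonneg (hc.le.trans (hf x).1) (h.pi_pos x).le)
    linarith
  rw [← h.fisher_eq_energy hM1 hp hc hf, fisher, integ, integ]
  calc _ = 2 * (κ / (2 - p) * ∑' x, f x * Psi k p f x * π x) := by field_simp
    _ ≤ _ := mul_le_mul_of_nonneg_left hle (by norm_num)

/-- Exponential decay of the Fisher information. -/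
theorem energy_semigroup_le (hp : p ∈ Ioo (1 : ℝ) 2) (hCD : CD k p κ) (hc : 0 < c)
    (hf : ∀ x, f x ∈ Icc c C) {t : ℝ} (ht : 0 ≤ t) :
    energy k π (semigroup k t f) (fun x => PhiD p (semigroup k t f x))
      ≤ Real.exp (-(2 * κ * t)) * energy k π f (fun x => PhiD p (f x)) := by
  set I : ℝ → ℝ := fun s => energy k π (semigroup k s f) (fun x => PhiD p (semigroup k s f x))
    with hI
  have hd : ∀ s ∈ Ici (0 : ℝ), HasDerivWithinAt (fun s => Real.exp (2 * κ * s) * I s)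
      (Real.exp (2 * κ * s) * (2 * κ * 1) * I s + Real.exp (2 * κ * s) *
        -(2 * integ π (fun x => semigroup k s f x * Psi2 k p (semigroup k s f) x)))
      (Ici 0) s := fun s hs =>
    (((hasDerivAt_id s).const_mul (2 * κ)).exp.hasDerivWithinAt).fun_mul
      (h.hasDerivWithinAt_energy hM1 hp hc hf hs)
  have hanti : AntitoneOn (fun s => Real.exp (2 * κ * s) * I s) (Ici 0) := by
    refine antitoneOn_of_hasDerivWithinAt_nonpos (convex_Ici 0)
      (fun s hs => (hd s hs).continuousWithinAt)
      (fun s hs => (hd s (interior_subset hs)).mono interior_subset) (fun s hs => ?_)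
    have := h.mul_energy_le_of_CD hM1 hp hCD hc (h.semigroup_mem_Icc hf (interior_subset hs))
    have h3 := mul_le_mul_of_nonneg_left this (Real.exp_pos (2 * κ * s)).le
    simp only [hI]
    linarith
  have h1 := hanti (mem_Ici.2 le_rfl) (mem_Ici.2 ht) ht
  simp only [mul_zero, Real.exp_zero, one_mul] at h1
  have h0 : I 0 = energy k π f (fun x => PhiD p (f x)) := by
    rw [hI]
    dsimp only
    rw [h.semigroup_zero (fun x => ⟨hc.le.trans (hf x).1, (hf x).2⟩)]
  rw [← h0]
  calc I t = Real.exp (-(2 * κ * t)) * (Real.exp (2 * κ * t) * I t) := by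
        rw [← mul_assoc, ← Real.exp_add]
        simp
    _ ≤ _ := mul_le_mul_of_nonneg_left h1 (Real.exp_pos _).le

-- A single term of the nonnegative energy series, so decay of the energy forces the increment
-- across each edge of positive rate to vanish.
omit [Countable X] in
theorem mul_sq_sub_le_energy (hp : p ∈ Ioo (1 : ℝ) 2) (hc : 0 < c)
    (hf : ∀ x, f x ∈ Icc c C) (x y : X) :
    rate k x y * π x * (1 / 2 * (C ^ (p - 2) * (f y - f x) ^ 2)) ≤
      energy k π f (fun x => PhiD p (f x)) := by
  have hpos : ∀ x, 0 < f x := fun x => hc.trans_le (hf x).1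
  have hs := h.summable_energy hM1 (g := f) (f := fun x => PhiD p (f x)) (IsBdd.of_Icc hf)
    (h.rateGrowth (isBdd_PhiD hp hc hf))
  refine le_trans ?_ (hs.le_tsum (x, y) fun q _ => mul_nonneg (h.edgeWeight_nonneg q)
    (mul_nonneg (by norm_num) (mul_PhiD_sub_nonneg hp (hpos _) (hpos _))))
  refine mul_le_mul_of_nonneg_left ?_ (h.edgeWeight_nonneg (x, y))
  exact mul_le_mul_of_nonneg_left
    (mul_sq_le_mul_PhiD_sub hp ⟨hpos x, (hf x).2⟩ ⟨hpos y, (hf y).2⟩) (by norm_num)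

/-- Under a positive curvature bound the semigroup equidistributes. -/
theorem tendsto_semigroup_sub (hp : p ∈ Ioo (1 : ℝ) 2) (hκ : 0 < κ) (hCD : CD k p κ) (hc : 0 < c)
    (hf : ∀ x, f x ∈ Icc c C) (x y : X) :
    Tendsto (fun t => semigroup k t f y - semigroup k t f x) atTop (𝓝 0) := by
  have edge : ∀ a b, 0 < k a b →
      Tendsto (fun t => semigroup k t f b - semigroup k t f a) atTop (𝓝 0) := by
    intro a b hab
    -- `rate` vanishes on the diagonal, so the division below needs b ≠ a.
    by_cases hne : b = a
    · simp [hne]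
    have hC : 0 < C := hc.trans_le ((hf x).1.trans (hf x).2)
    have hw : 0 < rate k a b * π a * (1 / 2 * C ^ (p - 2)) := by
      have := h.pi_pos a
      have hr : rate k a b = k a b := by simp [rate, hne]
      rw [hr]
      positivity
    set E := energy k π f (fun x => PhiD p (f x))
    have hlim : Tendsto (fun t => Real.exp (-(2 * κ * t)) * E /
        (rate k a b * π a * (1 / 2 * C ^ (p - 2)))) atTop (𝓝 0) := by
      have h1 : Tendsto (fun t : ℝ => Real.exp (-(2 * κ * t))) atTop (𝓝 0) :=
        Real.tendsto_exp_neg_atTop_nhds_zero.comp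
          (tendsto_id.const_mul_atTop (by positivity : 0 < 2 * κ))
      simpa using (h1.mul_const E).div_const (rate k a b * π a * (1 / 2 * C ^ (p - 2)))
    have hsq : Tendsto (fun t => (semigroup k t f b - semigroup k t f a) ^ 2) atTop (𝓝 0) := by
      refine tendsto_of_tendsto_of_tendsto_of_le_of_le' tendsto_const_nhds hlim
        (Eventually.of_forall fun t => sq_nonneg _) ?_
      filter_upwards [eventually_ge_atTop (0 : ℝ)] with t ht
      rw [le_div_iff₀ hw]
      have h2 := h.mul_sq_sub_le_energy hM1 hp hc (h.semigroup_mem_Icc hf ht) a b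
      have h3 := h.energy_semigroup_le hM1 hp hCD hc hf ht
      linarith
    have := hsq.sqrt
    simp only [Real.sqrt_sq_eq_abs, Real.sqrt_zero] at this
    exact (tendsto_zero_iff_abs_tendsto_zero _).2 this
  -- Differences along a path of positive rates add up.
  have hxy := h.irreducible x y
  induction hxy with
  | single hab => exact edge _ _ hab
  | tail _ hab ih => simpa using (edge _ _ hab).add ih

/-- By conservation of mass, P_t f(x) - 1 is the μ-average over y of P_t f(x) - P_t f(y), and these
differences tend to 0 boundedly. -/
theorem tendsto_semigroup (hp : p ∈ Ioo (1 : ℝ) 2) (hκ : 0 < κ) (hCD : CD k p κ) (hc : 0 < c)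
    (hf : ∀ x, f x ∈ Icc c C) (hsum : HasSum (fun x => f x * π x) 1) (x : X) :
    Tendsto (fun t => semigroup k t f x) atTop (𝓝 1) := by
  have h1 : Tendsto (fun t => ∑' y, (semigroup k t f x - semigroup k t f y) * π y) atTop
      (𝓝 (∑' y, 0 * π y)) := by
    refine tendsto_tsum_of_dominated_convergence (bound := fun y => (C - c) * π y)
      (h.pi_sum.summable.mul_left _)
      (fun y => (h.tendsto_semigroup_sub hM1 hp hκ hCD hc hf y x).mul_const _) ?_
    filter_upwards [eventually_ge_atTop (0 : ℝ)] with t ht y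
    have hx := h.semigroup_mem_Icc hf ht x
    have hy := h.semigroup_mem_Icc hf ht y
    rw [norm_mul, Real.norm_of_nonneg (h.pi_pos y).le, Real.norm_eq_abs]
    refine mul_le_mul_of_nonneg_right ?_ (h.pi_pos y).le
    rw [abs_le]
    constructor <;> linarith [hx.1, hx.2, hy.1, hy.2]
  have h2 : Tendsto (fun t => semigroup k t f x - 1) atTop (𝓝 0) := by
    simp only [zero_mul, tsum_zero] at h1
    refine h1.congr' ?_
    filter_upwards [eventually_ge_atTop (0 : ℝ)] with t ht
    have s1 := h.pi_sum.mul_left (semigroup k t f x)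
    have s2 := h.hasSum_semigroup_mul hM1 hc hf hsum ht
    rw [← mul_one (semigroup k t f x), ← (s1.sub s2).tsum_eq]
    exact tsum_congr fun y => by ring
  simpa using h2.add_const 1

theorem tendsto_entropy (hp : p ∈ Ioo (1 : ℝ) 2) (hκ : 0 < κ) (hCD : CD k p κ) (hc : 0 < c)
    (hf : ∀ x, f x ∈ Icc c C) (hsum : HasSum (fun x => f x * π x) 1) :
    Tendsto (fun t => entropy π p (semigroup k t f)) atTop (𝓝 0) := by
  have h0 : ∑' x, Phi p 1 * π x = 0 := by simp [Phi]
  rw [← h0]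
  obtain ⟨A, hA⟩ := isCompact_Icc.exists_bound_of_continuousOn
    (f := Phi p) (s := Icc c C) fun r hr =>
      (hasDerivAt_Phi p (hc.trans_le hr.1)).continuousAt.continuousWithinAt
  refine tendsto_tsum_of_dominated_convergence (bound := fun y => A * π y)
    (h.pi_sum.summable.mul_left _) (fun x => ?_) ?_
  · exact ((hasDerivAt_Phi p one_pos).continuousAt.tendsto.comp
      (h.tendsto_semigroup hM1 hp hκ hCD hc hf hsum x)).mul_const _
  · filter_upwards [eventually_ge_atTop (0 : ℝ)] with t ht x
    rw [norm_mul, Real.norm_of_nonneg (h.pi_pos x).le]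
    exact mul_le_mul_of_nonneg_right (hA _ (h.semigroup_mem_Icc hf ht x)) (h.pi_pos x).le

/-- The Beckner inequality for densities that are bounded and bounded away from zero. -/
theorem entropy_le_energy (hp : p ∈ Ioo (1 : ℝ) 2) (hκ : 0 < κ) (hCD : CD k p κ) (hc : 0 < c)
    (hf : ∀ x, f x ∈ Icc c C) (hsum : HasSum (fun x => f x * π x) 1) :
    entropy π p f ≤ 1 / (2 * κ) * energy k π f (fun x => PhiD p (f x)) := by
  set I : ℝ → ℝ := fun s => energy k π (semigroup k s f) (fun x => PhiD p (semigroup k s f x))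
    with hI
  set H : ℝ → ℝ := fun s => entropy π p (semigroup k s f) with hH
  have hd : ∀ s ∈ Ici (0 : ℝ), HasDerivWithinAt (fun s => H s - 1 / (2 * κ) * I s)
      (-I s - 1 / (2 * κ) *
        -(2 * integ π (fun x => semigroup k s f x * Psi2 k p (semigroup k s f) x)))
      (Ici 0) s := fun s hs =>
    (h.hasDerivWithinAt_entropy hM1 hp hc hf hs).fun_sub
      ((h.hasDerivWithinAt_energy hM1 hp hc hf hs).const_mul _)
  have hmono : MonotoneOn (fun s => H s - 1 / (2 * κ) * I s) (Ici 0) := by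
    refine monotoneOn_of_hasDerivWithinAt_nonneg (convex_Ici 0)
      (fun s hs => (hd s hs).continuousWithinAt)
      (fun s hs => (hd s (interior_subset hs)).mono interior_subset) (fun s hs => ?_)
    have h1 := h.mul_energy_le_of_CD hM1 hp hCD hc (h.semigroup_mem_Icc hf (interior_subset hs))
    have h2 := mul_le_mul_of_nonneg_left h1 (by positivity : 0 ≤ 1 / (2 * κ))
    have h3 : 1 / (2 * κ) * (2 * κ * I s) = I s := by field_simp
    simp only [hI] at h3 ⊢
    linarith
  have h0 : semigroup k 0 f = f :=
    h.semigroup_zero (fun x => ⟨hc.le.trans (hf x).1, (hf x).2⟩)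
  -- The energy at time t is nonnegative and may be discarded, so only the limit of the entropy is
  -- needed.
  have hle : ∀ᶠ t in atTop, H 0 - 1 / (2 * κ) * I 0 ≤ H t := by
    filter_upwards [eventually_ge_atTop (0 : ℝ)] with t ht
    have h1 := hmono (mem_Ici.2 le_rfl) (mem_Ici.2 ht) ht
    have h2 : 0 ≤ 1 / (2 * κ) * I t := mul_nonneg (by positivity)
      (h.energy_PhiD_nonneg hp fun x => hc.trans_le (h.semigroup_mem_Icc hf ht x).1)
    dsimp only at h1
    linarith
  have := ge_of_tendsto (h.tendsto_entropy hM1 hp hκ hCD hc hf hsum) hle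
  simp only [hH, hI, h0] at this
  linarith

end IsReversibleMarkovChain

end Decay

/-! ### Extension to all positive densities of finite entropy -/

section Truncation

variable {p : ℝ}

/-- If both points lie below a or both above b, the clamped increment is zero. Otherwise clamping
can only lower the larger point and raise the smaller one. -/
theorem clamp_sub_le {F : ℝ → ℝ} (hF : ∀ r s, 0 < r → r ≤ s → F r ≤ F s) {a b r s : ℝ}
    (ha : 0 < a) (hab : a ≤ b) (hr : 0 < r) (hrs : r ≤ s) :
    F (min (max s a) b) - F (min (max r a) b) ≤ F s - F r := by
  have hmono := hF r s hr hrs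
  rcases le_total s a with hs | hs
  · rw [max_eq_right hs, max_eq_right (hrs.trans hs)]
    linarith
  rcases le_total b r with hb | hb
  · rw [min_eq_right (hb.trans (le_max_left _ _)),
      min_eq_right ((hb.trans hrs).trans (le_max_left _ _))]
    linarith
  · have h1 : F (min (max s a) b) ≤ F s := by
      rw [max_eq_left hs]
      exact hF _ _ (lt_min (hr.trans_le hrs) (ha.trans_le hab)) (min_le_left _ _)
    have h2 : F r ≤ F (min (max r a) b) := by
      rw [min_eq_left (max_le hb hab)]
      exact hF _ _ hr (le_max_left _ _)
    linarith

theorem clamp_mem_Icc {a b : ℝ} (hab : a ≤ b) (r : ℝ) : min (max r a) b ∈ Icc a b :=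
  ⟨le_min (le_max_right _ _) hab, min_le_right _ _⟩

theorem clamp_mul_PhiD_le (hp : p ∈ Ioo (1 : ℝ) 2) {a b r s : ℝ} (ha : 0 < a) (hab : a ≤ b)
    (hr : 0 < r) (hs : 0 < s) :
    (min (max s a) b - min (max r a) b) *
        (PhiD p (min (max s a) b) - PhiD p (min (max r a) b))
      ≤ (s - r) * (PhiD p s - PhiD p r) := by
  wlog hrs : r ≤ s generalizing r s
  · have := this hs hr (le_of_not_ge hrs)
    linarith
  have hle : min (max r a) b ≤ min (max s a) b := min_le_min_right _ (max_le_max_right _ hrs)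
  exact mul_le_mul (clamp_sub_le (F := id) (fun _ _ _ h => h) ha hab hr hrs)
    (clamp_sub_le (fun _ _ => PhiD_mono hp) ha hab hr hrs)
    (sub_nonneg.2 (PhiD_mono hp (ha.trans_le (clamp_mem_Icc hab r).1) hle))
    (sub_nonneg.2 hrs)

/-- The additive constant of Φ_p' cancels, leaving a homogeneous function of degree p - 1.
Normalising by d therefore scales the energy by exactly d^(-p). -/
theorem PhiD_div_sub {r s d : ℝ} (hr : 0 < r) (hs : 0 < s) (hd : 0 < d) :
    PhiD p (s / d) - PhiD p (r / d) = (PhiD p s - PhiD p r) / d ^ (p - 1) := by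
  rw [PhiD_eq hr, PhiD_eq hs, PhiD_eq (div_pos hr hd), PhiD_eq (div_pos hs hd),
    Real.div_rpow hr.le hd.le, Real.div_rpow hs.le hd.le]
  ring

variable {X : Type*} {k : X → X → ℝ} {π : X → ℝ} {f : X → ℝ}

theorem fisherExt_clamp_div_le (h : IsReversibleMarkovChain k π) (hp : p ∈ Ioo (1 : ℝ) 2)
    (hf : ∀ x, 0 < f x) {a b d : ℝ} (ha : 0 < a) (hab : a ≤ b) (hd : 0 < d) :
    fisherExt k π p (fun x => min (max (f x) a) b / d)
      ≤ ENNReal.ofReal (1 / d * (1 / d ^ (p - 1))) * fisherExt k π p f := by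
  have hd' : 0 < d ^ (p - 1) := Real.rpow_pos_of_pos hd _
  simp only [fisherExt, ← ENNReal.tsum_mul_left]
  refine ENNReal.tsum_le_tsum fun x => ENNReal.tsum_le_tsum fun y => ?_
  rw [← ENNReal.ofReal_mul (by positivity)]
  refine ENNReal.ofReal_le_ofReal ?_
  by_cases hxy : y = x
  · simp [hxy]
  have hg : ∀ x, 0 < min (max (f x) a) b := fun x => ha.trans_le (clamp_mem_Icc hab _).1
  have h1 := clamp_mul_PhiD_le hp ha hab (hf x) (hf y)
  rw [PhiD_div_sub (hg x) (hg y) hd]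
  have h2 : 0 ≤ 1 / d * (1 / d ^ (p - 1)) * (1 / 2) * (k x y * π x) :=
    mul_nonneg (by positivity) (mul_nonneg (h.nonneg x y hxy) (h.pi_pos x).le)
  have h3 := mul_le_mul_of_nonneg_left h1 h2
  calc _ = 1 / d * (1 / d ^ (p - 1)) * (1 / 2) * (k x y * π x) *
        ((min (max (f y) a) b - min (max (f x) a) b) *
          (PhiD p (min (max (f y) a) b) - PhiD p (min (max (f x) a) b))) := by ring
    _ ≤ _ := h3
    _ = _ := by ring

/-- The truncation levels `1 / (n + 1)` and `n + 1`. -/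
noncomputable def truncate (n : ℕ) (r : ℝ) : ℝ := min (max r (1 / ((n : ℝ) + 1))) ((n : ℝ) + 1)

theorem one_div_le_succ (n : ℕ) : 1 / ((n : ℝ) + 1) ≤ (n : ℝ) + 1 := by
  have : (1 : ℝ) ≤ (n : ℝ) + 1 := by simp
  exact ((div_le_one (by positivity)).2 this).trans this

theorem truncate_mem_Icc (n : ℕ) (r : ℝ) :
    truncate n r ∈ Icc (1 / ((n : ℝ) + 1)) ((n : ℝ) + 1) :=
  clamp_mem_Icc (one_div_le_succ n) r

theorem truncate_pos (n : ℕ) (r : ℝ) : 0 < truncate n r :=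
  lt_of_lt_of_le (by positivity) (truncate_mem_Icc n r).1

theorem truncate_le (n : ℕ) {r : ℝ} (hr : 0 < r) : truncate n r ≤ r + 1 := by
  refine (min_le_left _ _).trans (max_le (by linarith) ?_)
  have : 1 / ((n : ℝ) + 1) ≤ 1 := (div_le_one (by positivity)).2 (by simp)
  linarith

theorem tendsto_truncate {r : ℝ} (hr : 0 < r) : Tendsto (fun n => truncate n r) atTop (𝓝 r) := by
  refine tendsto_const_nhds.congr' ?_
  filter_upwards [tendsto_one_div_add_atTop_nhds_zero_nat.eventually (gt_mem_nhds hr),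
    tendsto_natCast_atTop_atTop.eventually (eventually_ge_atTop r)] with n h1 h2
  rw [truncate, max_eq_left h1.le, min_eq_left (by linarith)]

/-- Domination for the renormalised truncations: s is at most r + 1 divided by a mass above 1/2. The
constant 16 is 4², from s ≤ 4 max(r,1) and p < 2. -/
theorem abs_Phi_le (hp : p ∈ Ioo (1 : ℝ) 2) {r s : ℝ} (hr : 0 < r) (hs : 0 < s)
    (hsr : s ≤ 2 * (r + 1)) :
    |Phi p s| ≤ 16 * (r ^ p + r + 1) / (p * (p - 1)) := by
  have h0 : 0 < p := by linarith [hp.1]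
  have h1 : 0 < p - 1 := by linarith [hp.1]
  have hp' : 0 < p * (p - 1) := by positivity
  have hs' : s ^ p ≤ 16 * (r ^ p + 1) := by
    have hm : 0 ≤ max r 1 := hr.le.trans (le_max_left _ _)
    have hsm : s ≤ 4 * max r 1 := by linarith [le_max_left r 1, le_max_right r 1]
    have h4 : (4 : ℝ) ^ p ≤ 16 := by
      calc (4 : ℝ) ^ p ≤ (4 : ℝ) ^ (2 : ℝ) :=
            Real.rpow_le_rpow_of_exponent_le (by norm_num) hp.2.le
        _ = 16 := by norm_num
    have hmp : (max r 1) ^ p ≤ r ^ p + 1 := by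
      have := Real.rpow_nonneg hr.le p
      rcases max_choice r 1 with hmx | hmx <;> rw [hmx]
      · linarith
      · rw [Real.one_rpow]
        linarith
    calc s ^ p ≤ (4 * max r 1) ^ p := Real.rpow_le_rpow hs.le hsm h0.le
      _ = 4 ^ p * (max r 1) ^ p := Real.mul_rpow (by norm_num) hm
      _ ≤ 16 * (r ^ p + 1) := mul_le_mul h4 hmp (Real.rpow_nonneg hm p) (by norm_num)
  rw [Phi, abs_div, abs_of_pos hp']
  refine div_le_div_of_nonneg_right ?_ hp'.le
  have := Real.rpow_nonneg hs.le p
  have := Real.rpow_nonneg hr.le p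
  rw [abs_le]
  constructor <;> linarith

/-- The Beckner inequality extends from the densities that are bounded and bounded away from zero
to all positive densities of finite entropy. -/
theorem bec_of_forall_Icc (h : IsReversibleMarkovChain k π) (hp : p ∈ Ioo (1 : ℝ) 2) {κ : ℝ}
    (hκ : 0 < κ)
    (hB : ∀ (f : X → ℝ) (c C : ℝ), 0 < c → (∀ x, f x ∈ Icc c C) →
      HasSum (fun x => f x * π x) 1 →
      ENNReal.ofReal (entropy π p f) ≤ ENNReal.ofReal (1 / (2 * κ)) * fisherExt k π p f) :
    Bec k π p κ := by
  rintro f ⟨⟨-, hsum⟩, hf⟩ hΦ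
  have hp0 : 0 < p * (p - 1) := mul_pos (by linarith [hp.1]) (by linarith [hp.1])
  set d : ℕ → ℝ := fun n => ∑' x, truncate n (f x) * π x with hd
  have hsd : ∀ n, Summable fun x => truncate n (f x) * π x := fun n =>
    h.summable_bdd_mul (IsBdd.of_Icc fun x => truncate_mem_Icc n (f x))
  have hdpos : ∀ n, 0 < d n := fun n => by
    have := hasSum_le (fun x => mul_le_mul_of_nonneg_right (truncate_mem_Icc n (f x)).1
      (h.pi_pos x).le) (h.pi_sum.mul_left (1 / ((n : ℝ) + 1))) (hsd n).hasSum
    exact lt_of_lt_of_le (by positivity) this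
  have hd1 : Tendsto d atTop (𝓝 1) := by
    rw [← hsum.tsum_eq]
    refine tendsto_tsum_of_dominated_convergence (bound := fun x => f x * π x + π x)
      (hsum.summable.add h.pi_sum.summable)
      (fun x => (tendsto_truncate (hf x)).mul_const _) (Eventually.of_forall fun n x => ?_)
    rw [norm_mul, Real.norm_of_nonneg (h.pi_pos x).le, Real.norm_of_nonneg (truncate_pos n _).le]
    have := mul_le_mul_of_nonneg_right (truncate_le n (hf x)) (h.pi_pos x).le
    linarith
  set g : ℕ → X → ℝ := fun n x => truncate n (f x) / d n with hg
  have hH : Tendsto (fun n => entropy π p (g n)) atTop (𝓝 (entropy π p f)) := by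
    -- Finite entropy is p-integrability, as f^p = p(p-1) Φ_p(f) + f.
    have hfp : Summable fun x => f x ^ p * π x := by
      refine ((hΦ.mul_left (p * (p - 1))).add hsum.summable).congr fun x => ?_
      rw [Phi, ← mul_assoc, mul_div_cancel₀ _ hp0.ne']
      ring
    refine tendsto_tsum_of_dominated_convergence
      (bound := fun x => 16 * (f x ^ p + f x + 1) / (p * (p - 1)) * π x) ?_ (fun x => ?_) ?_
    · refine (((hfp.add hsum.summable).add h.pi_sum.summable).mul_left
        (16 / (p * (p - 1)))).congr fun x => ?_
      ring
    · have h1 : Tendsto (fun n => g n x) atTop (𝓝 (f x)) := by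
        have := (tendsto_truncate (hf x)).div hd1 one_ne_zero
        rwa [div_one] at this
      exact ((hasDerivAt_Phi p (hf x)).continuousAt.tendsto.comp h1).mul_const _
    · filter_upwards [hd1.eventually (lt_mem_nhds (by norm_num : (1 / 2 : ℝ) < 1))] with n hn x
      rw [norm_mul, Real.norm_of_nonneg (h.pi_pos x).le]
      refine mul_le_mul_of_nonneg_right (abs_Phi_le hp (hf x)
        (div_pos (truncate_pos n _) (hdpos n)) ?_) (h.pi_pos x).le
      rw [hg, div_le_iff₀ (hdpos n)]
      have := truncate_le n (hf x)
      nlinarith [hf x]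
  have hle : ∀ n, ENNReal.ofReal (entropy π p (g n)) ≤ ENNReal.ofReal (1 / (2 * κ)) *
      (ENNReal.ofReal (1 / d n * (1 / d n ^ (p - 1))) * fisherExt k π p f) := by
    intro n
    refine (hB (g n) (1 / ((n : ℝ) + 1) / d n) (((n : ℝ) + 1) / d n)
      (div_pos (by positivity) (hdpos n)) (fun x => ?_) ?_).trans ?_
    · have := truncate_mem_Icc n (f x)
      exact ⟨div_le_div_of_nonneg_right this.1 (hdpos n).le,
        div_le_div_of_nonneg_right this.2 (hdpos n).le⟩
    · have := (hsd n).hasSum.div_const (d n)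
      rw [div_self (hdpos n).ne'] at this
      exact this.congr_fun fun x => by simp only [hg]; ring
    · gcongr
      exact fisherExt_clamp_div_le h hp hf (by positivity) (one_div_le_succ n) (hdpos n)
  -- Multiplication by ∞ is not continuous on [0,∞], so infinite Fisher information is treated
  -- apart; there the bound is trivial because κ > 0.
  by_cases htop : fisherExt k π p f = ⊤
  · rw [htop, ENNReal.mul_top]
    · exact le_top
    · rw [Ne, ENNReal.ofReal_eq_zero, not_le]
      positivity
  · have hc : Tendsto (fun n => 1 / d n * (1 / d n ^ (p - 1))) atTop (𝓝 1) := by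
      have h1 : Tendsto (fun n => d n ^ (p - 1)) atTop (𝓝 1) := by
        simpa using hd1.rpow_const (p := p - 1) (Or.inl one_ne_zero)
      simpa using (hd1.inv₀ one_ne_zero).mul (h1.inv₀ one_ne_zero)
    have hc' := ENNReal.tendsto_ofReal hc
    have hlim := ENNReal.Tendsto.const_mul (a := ENNReal.ofReal (1 / (2 * κ)))
      (ENNReal.Tendsto.mul_const (b := fisherExt k π p f) hc' (Or.inr htop))
      (Or.inr ENNReal.ofReal_ne_top)
    rw [ENNReal.ofReal_one, one_mul] at hlim
    exact le_of_tendsto_of_tendsto' (ENNReal.tendsto_ofReal hH) hlim hle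

end Truncation

end BecknerChain

/-! ### Assembly of the four assertions -/

open BecknerChain
theorem theorem5p6 {X : Type*} [Countable X] (k : X → X → ℝ) (π : X → ℝ)
    (hchain : IsReversibleMarkovChain k π)
    (hM1 : Summable (fun x => M1 k x ^ 2 * π x))
    (hM2 : Summable (fun x => M2 k x * π x))
    (p : ℝ) (hp : p ∈ Ioo (1 : ℝ) 2) :
    -- the two formulas for the Fisher information agree on `𝒫_*^+(X)`
    (∀ ρ ∈ DensPosPlus π,
      Summable (fun x => ρ x * Psi k p ρ x * π x) ∧
      0 ≤ fisher k π p ρ ∧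
      fisherExt k π p ρ = ENNReal.ofReal (fisher k π p ρ)) ∧
    -- first and second derivative of the entropy along the semigroup (one-sided at `t = 0`)
    (∀ f ∈ DensPosPlus π, ∀ t : ℝ, 0 ≤ t →
      semigroup k t f ∈ DensPosPlus π ∧
      Summable (fun x => Phi p (semigroup k t f x) * π x) ∧
      HasDerivWithinAt (fun s => entropy π p (semigroup k s f))
        (-fisher k π p (semigroup k t f)) (Ici 0) t ∧
      Summable (fun x => semigroup k t f x * Psi2 k p (semigroup k t f) x * π x) ∧
      HasDerivWithinAt (derivWithin (fun s => entropy π p (semigroup k s f)) (Ici 0))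
        (2 * integ π (fun x => semigroup k t f x * Psi2 k p (semigroup k t f) x)) (Ici 0) t) ∧
    -- the differential inequality under the curvature-dimension condition
    (∀ κ : ℝ, CD k p κ → ∀ f ∈ DensPosPlus π, ∀ t : ℝ, 0 < t →
      -2 * κ * deriv (fun s => entropy π p (semigroup k s f)) t ≤
        deriv (deriv (fun s => entropy π p (semigroup k s f))) t) ∧
    -- the Beckner inequality
    (∀ κ : ℝ, 0 < κ → CD k p κ → Bec k π p κ) := by

  have hIcc : ∀ ρ ∈ DensPosPlus π, ∃ c C, 0 < c ∧ ∀ x, ρ x ∈ Icc c C := by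
    rintro ρ ⟨-, ⟨C, hC⟩, c, hc, hρ⟩
    exact ⟨c, C, hc, fun x => ⟨hρ x, (le_abs_self _).trans (hC x)⟩⟩
  have hfisher : ∀ f ∈ DensPosPlus π, ∀ t : ℝ, 0 ≤ t →
      fisher k π p (semigroup k t f)
        = energy k π (semigroup k t f) (fun x => PhiD p (semigroup k t f x)) := by
    intro f hf t ht
    obtain ⟨c, C, hc, hfc⟩ := hIcc f hf
    exact hchain.fisher_eq_energy hM1 hp hc (hchain.semigroup_mem_Icc hfc ht)
  have hderiv : ∀ f ∈ DensPosPlus π, ∀ t : ℝ, 0 ≤ t →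
      HasDerivWithinAt (fun s => entropy π p (semigroup k s f))
        (-fisher k π p (semigroup k t f)) (Ici 0) t := by
    intro f hf t ht
    obtain ⟨c, C, hc, hfc⟩ := hIcc f hf
    rw [hfisher f hf t ht]
    exact hchain.hasDerivWithinAt_entropy hM1 hp hc hfc ht
  have hderiv2 : ∀ f ∈ DensPosPlus π, ∀ t : ℝ, 0 ≤ t →
      HasDerivWithinAt (derivWithin (fun s => entropy π p (semigroup k s f)) (Ici 0))
        (2 * integ π (fun x => semigroup k t f x * Psi2 k p (semigroup k t f) x)) (Ici 0) t := by
    intro f hf t ht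
    obtain ⟨c, C, hc, hfc⟩ := hIcc f hf
    have h1 := (hchain.hasDerivWithinAt_energy hM1 hp hc hfc ht).fun_neg
    rw [neg_neg] at h1
    -- The first derivative is identified on all of [0,∞), not only at t, so that it can be
    -- differentiated again.
    have h2 : ∀ s ∈ Ici (0 : ℝ), derivWithin (fun s => entropy π p (semigroup k s f)) (Ici 0) s
        = -energy k π (semigroup k s f) (fun x => PhiD p (semigroup k s f x)) := fun s hs => by
      rw [(hderiv f hf s hs).derivWithin (uniqueDiffOn_Ici 0 s hs), hfisher f hf s hs]
    exact h1.congr h2 (h2 t ht)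
  refine ⟨fun ρ hρ => ?_, fun f hf t ht => ?_, fun κ hCD f hf t ht => ?_, fun κ hκ hCD => ?_⟩
  · obtain ⟨c, C, hc, hρc⟩ := hIcc ρ hρ
    have h1 := hchain.fisher_eq_energy hM1 hp hc hρc
    refine ⟨hchain.summable_mul_Psi hM1 hp hc hρc, ?_, ?_⟩
    · rw [h1]
      exact hchain.energy_PhiD_nonneg hp fun x => hc.trans_le (hρc x).1
    · rw [h1]
      exact hchain.fisherExt_eq_energy hM1 hp hc hρc
  · obtain ⟨c, C, hc, hfc⟩ := hIcc f hf
    have hu := hchain.semigroup_mem_Icc hfc ht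
    have hpos : ∀ x, 0 < semigroup k t f x := fun x => hc.trans_le (hu x).1
    obtain ⟨A, -, hA⟩ := IsBdd.of_Icc hu
    exact ⟨⟨⟨⟨fun x => (hpos x).le, hchain.hasSum_semigroup_mul hM1 hc hfc hf.1.1.2 ht⟩, hpos⟩,
      ⟨A, hA⟩, c, hc, fun x => (hu x).1⟩, hchain.summable_bdd_mul (isBdd_Phi p hc hu),
      hderiv f hf t ht, (hchain.integ_mul_Psi2 hM1 hp hc hu).1, hderiv2 f hf t ht⟩
  · obtain ⟨c, C, hc, hfc⟩ := hIcc f hf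
    have hderiv_eq : ∀ s : ℝ, 0 < s → deriv (fun s => entropy π p (semigroup k s f)) s
        = derivWithin (fun s => entropy π p (semigroup k s f)) (Ici 0) s := fun s hs =>
      (derivWithin_of_mem_nhds (Ici_mem_nhds hs)).symm
    -- For t > 0 the one-sided and two-sided first derivatives agree near t, hence so do the second
    -- derivatives at t.
    have h1 := ((hderiv2 f hf t ht.le).hasDerivAt (Ici_mem_nhds ht)).congr_of_eventuallyEq
      (Filter.eventuallyEq_of_mem (Ioi_mem_nhds ht) hderiv_eq)
    rw [h1.deriv, ((hderiv f hf t ht.le).hasDerivAt (Ici_mem_nhds ht)).deriv,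
      hfisher f hf t ht.le]
    have := hchain.mul_energy_le_of_CD hM1 hp hCD hc (hchain.semigroup_mem_Icc hfc ht.le)
    linarith
  · refine bec_of_forall_Icc hchain hp hκ fun f c C hc hf hsum => ?_
    rw [hchain.fisherExt_eq_energy hM1 hp hc hf, ← ENNReal.ofReal_mul (by positivity)]
    exact ENNReal.ofReal_le_ofReal (hchain.entropy_le_energy hM1 hp hκ hCD hc hf hsum)
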